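/- Let $p$ be a prime and let $G$ be a locally compact abelian group whose topology is generated by a chain of open subgroups $\cdots\supset G_{-1}\supset G_0\supset G_1\supset\cdots$ with $\bigcup_n G_n=G$, $\bigcap_n G_n=\{0\}$ and $|G_n/G_{n+1}|=p$ for all $n\in\mathbb Z$. Fix $g_n\in G_n\setminus G_{n+1}$; every $x\in G$ is uniquely $x=\sum_n a_ng_n$ with $a_n\in\{0,\dots,p-1\}$ and $a_n=0$ for all sufficiently negative $n$. Assume that the bijection $\mathcal A:\sum a_ng_n\mapsto\sum a_ng_{n-1}$ of $G$ is additive (for instance $G=\mathbb Q_p$, $g_n=p^n$, $\mathcal Ax=x/p$). Let $X$ be the group of continuous unitary characters of $G$, let $(\chi,x)$ be the value of $\chi\in X$ at $x$, put $(\chi\mathcal A^k,x)=(\chi,\mathcal A^kx)$ for $k\in\mathbb Z$ and $G_n^\perp=\{\chi\in X:\chi|_{G_n}=1\}$, and fix $r_n\in G_{n+1}^\perp\setminus G_n^\perp$ for every $n\in\mathbb Z$. Let $\mu$ and $\nu$ be the Haar measures on $G$ and $X$ with $\mu(G_0)=\nu(G_0^\perp)=1$, and $\hat f(\chi)=\int_G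 f\,\overline{(\chi,\cdot)}\,d\mu$. Let $H_0$ be the set of all finite sums $a_{-1}g_{-1}+\dots+a_{-s}g_{-s}$ with digits $a_k\in\{0,\dots,p-1\}$. Let $M,N\ge 0$ be integers and let $\varphi:G\to\mathbb C$ be supported on $G_{-N}$ and constant on the cosets of $G_M$. Suppose that $\varphi$ is refinable with mask $m_0$, i.e. $\varphi(x)=p\sum_{h\in H_0}\beta_h\varphi(\mathcal Ax-h)$ for some $(\beta_h)\in\ell^2(H_0)$, and $m_0(\chi)=\sum_{h\in H_0}\beta_h\overline{(\chi\mathcal A^{-1},h)}$ (with convergence in $L_2(G_n^\perp)$ for every $n$). Let $m_1,\dots,m_q:X\to\mathbb C$ be functions (masks) such that 1. $\hat\varphi(\chi\mathcal A^{-1})\,m_j(\chi)=\mathbf 1_{E_j}(\chi)$ for all $\chi\in X$ and $j=1,\dots,q$, where $E_j=G_{-s(j)}^\perp\, r_{-s(j)}^{\alpha_{-s(j)}}r_{-s(j)+1}^{\alpha_{-s(j)+1}}\cdots r_M^{\alpha_M}$ with an integer $s(j)\ge 0$ and digits $\alpha_k=\alpha_k^{(j)}\in\{0,\dots,p-1\}$;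 the cosets $E_1,\dots,E_q$ are pairwise disjoint, and for every $t\in\mathbb Z$ so are the sets $E_1\mathcal A^t,\dots,E_q\mathcal A^t$; 2. there are integers $t(j)\ge0$ such that the sets $E_j\mathcal A^{t(j)}$ are pairwise disjoint and $\bigsqcup_{j=1}^q E_j\mathcal A^{t(j)}=G_{M+1}^\perp\setminus G_M^\perp$. Let $\psi^{(j)}$ be the function with $\hat\psi^{(j)}(\chi)=\hat\varphi(\chi\mathcal A^{-1})m_j(\chi)$, i.e. $\psi^{(j)}(x)=\int_X\hat\varphi(\chi\mathcal A^{-1})m_j(\chi)(\chi,x)\,d\nu(\chi)$. Then the functions $\psi^{(j)}_{n,h}(x)=p^{n/2}\psi^{(j)}(\mathcal A^nx-h)$, $1\le j\le q$, $n\in\mathbb Z$, $h\in H_0$, belong to $L_2(G)$ and form a Parseval (tight) wavelet frame of $L_2(G)$: for every $f\in L_2(G)$, $$\sum_{j,n,h}|\langle f,\psi^{(j)}_{n,h}\rangle|^2=\|f\|^2\quad\text{and}\quad \sum_{j,n,h}\langle f,\psi^{(j)}_{n,h}\rangle\,\psi^{(j)}_{n,h}=f .$$ -/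

import Mathlib

open MeasureTheory Filter Topology
open scoped ComplexConjugate ENNReal

/-- The group of continuous unitary characters of the additive topological group `G`
(Mathlib's Pontryagin dual, which is written for multiplicative groups). -/
abbrev CharGroup (G : Type*) [AddCommGroup G] [TopologicalSpace G] : Type _ :=
  PontryaginDual (Multiplicative G)

/-- The value `(χ, x)` of a character at a point, as a complex number. -/
noncomputable def charVal {G : Type*} [AddCommGroup G] [TopologicalSpace G]
    (χ : CharGroup G) (x : G) : ℂ :=
  ((χ (Multiplicative.ofAdd x) : Circle) : ℂ)

/-- A zero-dimensional group with a dilation operator: a basic chain `(Gₙ)` of open subgroups whose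
consecutive quotients have prime order `p`, a basic system `(gₙ)`, a Rademacher system `(rₙ)`, and
the operator `𝒜 : ∑ aₙ gₙ ↦ ∑ aₙ gₙ₋₁`, which is required to be additive. -/
structure ZeroDimGroup (G : Type*) [AddCommGroup G] [TopologicalSpace G] (p : ℕ) where
  prime : p.Prime
  /-- the basic chain -/
  chain : ℤ → AddSubgroup G
  isOpen_chain : ∀ n, IsOpen (chain n : Set G)
  chain_succ_le : ∀ n, chain (n + 1) ≤ chain n
  exists_mem_chain : ∀ x, ∃ n, x ∈ chain n
  eq_zero_of_mem_chain : ∀ x, (∀ n, x ∈ chain n) → x = 0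
  /-- the chain is a neighbourhood base at `0` -/
  exists_chain_subset : ∀ U ∈ 𝓝 (0 : G), ∃ n, (chain n : Set G) ⊆ U
  relIndex_chain : ∀ n, (chain (n + 1)).relIndex (chain n) = p
  /-- the basic system -/
  g : ℤ → G
  g_mem : ∀ n, g n ∈ chain n
  g_notMem : ∀ n, g n ∉ chain (n + 1)
  /-- the Rademacher system -/
  r : ℤ → CharGroup G
  r_trivial : ∀ n, ∀ x ∈ chain (n + 1), charVal (r n) x = 1
  r_nontrivial : ∀ n, ∃ x ∈ chain n, charVal (r n) x ≠ 1
  /-- the dilation operator -/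
  dil : G ≃+ G
  /-- `dil` is the digit shift -/
  dil_hasSum : ∀ (a : ℤ → ℕ) (x : G), (∀ n, a n < p) →
    HasSum (fun n => a n • g n) x → HasSum (fun n => a n • g (n - 1)) (dil x)

namespace ZeroDimGroup

section

variable {G : Type*} [AddCommGroup G] [TopologicalSpace G] {p : ℕ} (S : ZeroDimGroup G p)

theorem chain_anti {m n : ℤ} (h : m ≤ n) : S.chain n ≤ S.chain m :=
  antitone_int_of_succ_le S.chain_succ_le h

theorem exists_digit (n : ℤ) (x : G) (hx : x ∈ S.chain n) :
    ∃ a : ℕ, a < p ∧ x - a • S.g n ∈ S.chain (n + 1) := by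
  have : Fact p.Prime := ⟨S.prime⟩
  set K := (S.chain (n + 1)).addSubgroupOf (S.chain n) with hK
  have hcard : Nat.card (S.chain n ⧸ K) = p := S.relIndex_chain n
  have hg : ((⟨S.g n, S.g_mem n⟩ : S.chain n) : S.chain n ⧸ K) ≠ 0 := by
    rw [Ne, QuotientAddGroup.eq_zero_iff, hK, AddSubgroup.mem_addSubgroupOf]
    exact S.g_notMem n
  obtain ⟨k, hk⟩ := AddSubgroup.mem_zmultiples_iff.1
    (mem_zmultiples_of_prime_card (g' := ((⟨x, hx⟩ : S.chain n) : S.chain n ⧸ K)) hcard hg)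
  have hp0 : (p : ℤ) ≠ 0 := by exact_mod_cast S.prime.ne_zero
  have hpg : p • ((⟨S.g n, S.g_mem n⟩ : S.chain n) : S.chain n ⧸ K) = 0 := by
    have h := card_nsmul_eq_zero' (x := ((⟨S.g n, S.g_mem n⟩ : S.chain n) : S.chain n ⧸ K))
    rwa [hcard] at h
  refine ⟨(k % p).toNat, ?_, ?_⟩
  · have := Int.emod_lt_of_pos k (show (0 : ℤ) < p by exact_mod_cast S.prime.pos)
    have := Int.emod_nonneg k hp0
    omega
  · have h1 : (((k % p).toNat : ℕ) • ((⟨S.g n, S.g_mem n⟩ : S.chain n) : S.chain n ⧸ K)) =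
        ((⟨x, hx⟩ : S.chain n) : S.chain n ⧸ K) := by
      rw [← hk, ← natCast_zsmul, Int.toNat_of_nonneg (Int.emod_nonneg k hp0)]
      conv_rhs => rw [← Int.emod_add_mul_ediv k p]
      rw [add_zsmul, mul_comm (p : ℤ), mul_zsmul, natCast_zsmul, hpg, zsmul_zero, add_zero]
    have h2 : ((((k % p).toNat • (⟨S.g n, S.g_mem n⟩ : S.chain n) : S.chain n)) :
        S.chain n ⧸ K) = ((⟨x, hx⟩ : S.chain n) : S.chain n ⧸ K) := h1
    have h3 := QuotientAddGroup.eq.1 h2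
    rw [hK, AddSubgroup.mem_addSubgroupOf] at h3
    simpa [sub_eq_add_neg, add_comm] using h3

theorem smul_g_notMem (n : ℤ) (a : ℕ) (h0 : a ≠ 0) (ha : a < p) :
    a • S.g n ∉ S.chain (n + 1) := by
  intro h
  set K := (S.chain (n + 1)).addSubgroupOf (S.chain n) with hK
  have hcard : Nat.card (S.chain n ⧸ K) = p := S.relIndex_chain n
  have hpg : p • ((⟨S.g n, S.g_mem n⟩ : S.chain n) : S.chain n ⧸ K) = 0 := by
    have h := card_nsmul_eq_zero' (x := ((⟨S.g n, S.g_mem n⟩ : S.chain n) : S.chain n ⧸ K))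
    rwa [hcard] at h
  have hpm : p • S.g n ∈ S.chain (n + 1) := by
    have h2 : (((p • (⟨S.g n, S.g_mem n⟩ : S.chain n) : S.chain n)) : S.chain n ⧸ K) = 0 := hpg
    rw [QuotientAddGroup.eq_zero_iff, hK, AddSubgroup.mem_addSubgroupOf] at h2
    simpa using h2
  have hco : Nat.Coprime a p := (Nat.coprime_of_lt_prime h0 ha S.prime).symm
  apply S.g_notMem n
  have hb := Nat.gcd_eq_gcd_ab a p
  rw [hco] at hb
  have : S.g n = (Nat.gcdA a p) • (a • S.g n) + (Nat.gcdB a p) • (p • S.g n) := by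
    rw [← natCast_zsmul, ← natCast_zsmul, ← mul_zsmul, ← mul_zsmul, ← add_zsmul]
    rw [mul_comm (Nat.gcdA a p), mul_comm (Nat.gcdB a p), ← hb]
    simp
  rw [this]
  exact add_mem (zsmul_mem h _) (zsmul_mem hpm _)

theorem exists_expansion [IsTopologicalAddGroup G] (m : ℤ) (x : G) (hx : x ∈ S.chain m) :
    ∃ a : ℤ → ℕ, (∀ n, a n < p) ∧ (∀ n, n < m → a n = 0) ∧ HasSum (fun n => a n • S.g n) x := by
  have step : ∀ (n : ℤ) (y : G), ∃ a : ℕ, a < p ∧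
      (y ∈ S.chain n → y - a • S.g n ∈ S.chain (n + 1)) := by
    intro n y
    by_cases hy : y ∈ S.chain n
    · obtain ⟨a, h1, h2⟩ := S.exists_digit n y hy
      exact ⟨a, h1, fun _ => h2⟩
    · exact ⟨0, S.prime.pos, fun h => absurd h hy⟩
  choose d hd hd' using step
  let R : ℕ → G := fun i => Nat.rec x (fun i y => y - d (m + i) y • S.g (m + i)) i
  have hR : ∀ i : ℕ, R i ∈ S.chain (m + i) := by
    intro i
    induction i with
    | zero => simpa [R] using hx
    | succ i ih =>
      have := hd' _ _ ih
      push_cast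
      rw [← add_assoc]
      exact this
  have hsum : ∀ i, ∑ k ∈ Finset.range i, d (m + k) (R k) • S.g (m + k) = x - R i := by
    intro i
    induction i with
    | zero => simp [R]
    | succ i ih =>
      rw [Finset.sum_range_succ, ih]
      have : R (i + 1) = R i - d (m + i) (R i) • S.g (m + i) := rfl
      rw [this]; abel
  have hnat : HasSum (fun k : ℕ => d (m + k) (R k) • S.g (m + k)) x := by
    rw [HasSum, SummationFilter.unconditional_filter]
    intro U hU
    have hU' : (fun y => x + y) ⁻¹' U ∈ 𝓝 (0 : G) :=
      (continuous_const.add continuous_id).continuousAt.preimage_mem_nhds (by simpa using hU)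
    obtain ⟨n, hn⟩ := S.exists_chain_subset _ hU'
    rw [Filter.mem_map, Filter.mem_atTop_sets]
    refine ⟨Finset.range (n - m).toNat, fun T hT => ?_⟩
    have hle : n ≤ m + ((n - m).toNat : ℤ) := by omega
    have hT' : ∑ k ∈ T \ Finset.range (n - m).toNat, d (m + k) (R k) • S.g (m + k) ∈ S.chain n := by
      refine sum_mem fun k hk => nsmul_mem (S.chain_anti ?_ (S.g_mem _)) _
      simp only [Finset.mem_sdiff, Finset.mem_range] at hk
      omega
    have key := hn (sub_mem hT' (S.chain_anti hle (hR _)))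
    have e := Finset.sum_sdiff (f := fun k : ℕ => d (m + k) (R k) • S.g (m + k)) hT
    rw [hsum] at e
    simp only [Set.mem_preimage] at key ⊢
    rw [← e]
    convert key using 1
    abel
  have hinj : Function.Injective (fun k : ℕ => m + (k : ℤ)) := fun a b h => by
    simpa using h
  refine ⟨fun n => if m ≤ n then d n (R (n - m).toNat) else 0, fun n => ?_, fun n hn => ?_, ?_⟩
  · dsimp only
    split_ifs
    · exact hd _ _
    · exact S.prime.pos
  · simp [not_le.2 hn]
  · rw [← hinj.hasSum_iff]
    · convert hnat using 1
      funext k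
      simp
    · intro n hn
      have : ¬ m ≤ n := fun h => hn ⟨(n - m).toNat, by simp; omega⟩
      simp [this]

theorem isClosed_chain [IsTopologicalAddGroup G] (n : ℤ) : IsClosed (S.chain n : Set G) :=
  AddSubgroup.isClosed_of_isOpen _ (S.isOpen_chain n)

theorem t2Space (S : ZeroDimGroup G p) [IsTopologicalAddGroup G] : T2Space G := by
  have : IsClosed ({0} : Set G) := by
    have h : ({0} : Set G) = ⋂ n, (S.chain n : Set G) := by
      ext x
      simp only [Set.mem_singleton_iff, Set.mem_iInter, SetLike.mem_coe]
      exact ⟨fun h n => h ▸ zero_mem _, S.eq_zero_of_mem_chain x⟩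
    rw [h]
    exact isClosed_iInter S.isClosed_chain
  have : T1Space G := IsTopologicalAddGroup.t1Space G this
  infer_instance

theorem dil_g [IsTopologicalAddGroup G] (n : ℤ) : S.dil (S.g n) = S.g (n - 1) := by
  have := S.t2Space
  have h := S.dil_hasSum (Pi.single n 1) (S.g n)
    (fun k => by
      by_cases hk : k = n
      · subst hk; simpa using S.prime.one_lt
      · simpa [hk] using S.prime.pos)
    (by
      convert hasSum_single n (f := fun k => (Pi.single n 1 : ℤ → ℕ) k • S.g k) ?_ using 1
      · simp
      · intro k hk; simp [hk])
  refine h.unique ?_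
  convert hasSum_single n (f := fun k => (Pi.single n 1 : ℤ → ℕ) k • S.g (k - 1)) ?_ using 1
  · simp
  · intro k hk; simp [hk]

theorem dil_mem [IsTopologicalAddGroup G] (n : ℤ) (x : G) (hx : x ∈ S.chain n) :
    S.dil x ∈ S.chain (n - 1) := by
  obtain ⟨a, ha, ha0, hs⟩ := S.exists_expansion n x hx
  have h := S.dil_hasSum a x ha hs
  rw [HasSum, SummationFilter.unconditional_filter] at h
  refine (S.isClosed_chain (n - 1)).mem_of_tendsto h (Eventually.of_forall fun T => ?_)
  refine sum_mem fun k _ => ?_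
  by_cases hk : k < n
  · simp [ha0 k hk]
  · exact nsmul_mem (S.chain_anti (by omega) (S.g_mem _)) _

theorem mem_of_dil_mem [IsTopologicalAddGroup G] (n : ℤ) (x : G)
    (hx : S.dil x ∈ S.chain (n - 1)) : x ∈ S.chain n := by
  obtain ⟨m, hm⟩ := S.exists_mem_chain x
  have key : ∀ i : ℕ, m + i ≤ n → x ∈ S.chain (m + i) := by
    intro i
    induction i with
    | zero => intro _; simpa using hm
    | succ i ih =>
      intro hi
      push_cast at hi ⊢
      have hxi := ih (by omega)
      obtain ⟨a, ha, hxa⟩ := S.exists_digit _ x hxi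
      rw [← add_assoc]
      by_cases h0 : a = 0
      · simpa [h0] using hxa
      · exfalso
        have h1 := S.dil_mem _ _ hxa
        rw [map_sub, map_nsmul, S.dil_g] at h1
        have h2 : S.dil x ∈ S.chain (m + i + 1 - 1) := S.chain_anti (by omega) hx
        have h3 := sub_mem h2 h1
        rw [sub_sub_cancel] at h3
        refine S.smul_g_notMem (m + i - 1) a h0 ha ?_
        convert h3 using 2
        ring
  by_cases h : m ≤ n
  · have := key (n - m).toNat (by omega)
    rwa [show m + ((n - m).toNat : ℤ) = n by omega] at this
  · exact S.chain_anti (by omega) hm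

/-- The power `𝒜ᵏ`, `k ∈ ℤ`: Mathlib writes the composition of additive automorphisms
additively. -/
def dilPow (k : ℤ) : G ≃+ G := k • (show AddAut G from S.dil)

theorem dilPow_zero (x : G) : S.dilPow 0 x = x := by
  simp [dilPow]

theorem dilPow_add_one (k : ℤ) (x : G) : S.dilPow (k + 1) x = S.dilPow k (S.dil x) := by
  simp only [dilPow, add_zsmul, one_zsmul]; rfl

theorem continuous_dilPow [IsTopologicalAddGroup G] (k : ℤ) : Continuous (S.dilPow k) := by
  have hmem : ∀ (k n : ℤ) (x : G), x ∈ S.chain n → S.dilPow k x ∈ S.chain (n - k) := by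
    intro k
    induction k with
    | zero => intro n x hx; simpa [S.dilPow_zero] using hx
    | succ i ih =>
      intro n x hx
      rw [S.dilPow_add_one, show n - ((i : ℤ) + 1) = n - 1 - i by ring]
      exact ih _ _ (S.dil_mem _ _ hx)
    | pred i ih =>
      intro n x hx
      obtain ⟨y, rfl⟩ := S.dil.surjective x
      rw [← S.dilPow_add_one, show n - (-(i : ℤ) - 1) = n + 1 - (-(i : ℤ) - 1 + 1) by ring,
        show (-(i : ℤ) - 1 + 1) = -(i : ℤ) by ring]
      exact ih _ _ (S.mem_of_dil_mem _ _ (by simpa using hx))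
  refine continuous_of_continuousAt_zero (S.dilPow k).toAddMonoidHom ?_
  intro U hU
  simp only [AddEquiv.toAddMonoidHom_eq_coe, map_zero] at hU
  obtain ⟨n, hn⟩ := S.exists_chain_subset U hU
  refine Filter.mem_map.2 <| Filter.mem_of_superset ((S.isOpen_chain (n + k)).mem_nhds (zero_mem _)) fun x hx => hn ?_
  simpa using hmem k _ x hx

end

noncomputable section

variable {G : Type*} [AddCommGroup G] [TopologicalSpace G] [IsTopologicalAddGroup G]
  {p : ℕ} (S : ZeroDimGroup G p)

/-- `χ𝒜ᵏ`, the character `x ↦ (χ, 𝒜ᵏ x)`. -/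
def charDil (k : ℤ) (χ : CharGroup G) : CharGroup G :=
  PontryaginDual.map
    (⟨AddMonoidHom.toMultiplicative (S.dilPow k).toAddMonoidHom, S.continuous_dilPow k⟩ :
      Multiplicative G →ₜ* Multiplicative G) χ

theorem charVal_charDil (k : ℤ) (χ : CharGroup G) (x : G) :
    charVal (S.charDil k χ) x = charVal χ (S.dilPow k x) := rfl

/-- The annihilator `Gₙ^⊥`. -/
def ann (n : ℤ) : Set (CharGroup G) := {χ | ∀ x ∈ S.chain n, charVal χ x = 1}

/-- The coset `G₋ₛ^⊥ r₋ₛ^{α₋ₛ} ⋯ r_M^{α_M}`. -/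
def coset (s M : ℕ) (α : ℤ → Fin p) : Set (CharGroup G) :=
  {χ | ∃ η ∈ S.ann (-(s : ℤ)),
    χ = η * ∏ k ∈ Finset.Icc (-(s : ℤ)) (M : ℤ), S.r k ^ (α k : ℕ)}

/-- The set `H₀` of all sums `a₋₁ g₋₁ + ⋯ + a₋ₛ g₋ₛ` with digits `0 ≤ aₖ < p`. -/
def H₀ : Set G :=
  {h | ∃ (s : ℕ) (a : ℤ → Fin p), h = ∑ k ∈ Finset.Icc (-(s : ℤ)) (-1), (a k : ℕ) • S.g k}

/-- The class of step functions that are supported on `G₋N` and constant on the cosets of `G_M`. -/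
def IsStep (M N : ℕ) (f : G → ℂ) : Prop :=
  Function.support f ⊆ (S.chain (-(N : ℤ)) : Set G) ∧
    ∀ x, ∀ y ∈ S.chain (M : ℤ), f (x + y) = f x

/-- `φ` satisfies `φ(x) = p ∑_{h ∈ H₀} β_h φ(𝒜x - h)` for some `β ∈ ℓ²`, and
`m₀(χ) = ∑_{h ∈ H₀} β_h conj (χ𝒜⁻¹, h)` is its mask; the last series is understood in `L²` on every
annihilator `Gₙ^⊥`. For a step function `φ` the first series has finitely many nonzero terms
at each point. -/
def IsRefinable [MeasurableSpace (CharGroup G)] (ν : Measure (CharGroup G))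
    (φ : G → ℂ) (m₀ : CharGroup G → ℂ) : Prop :=
  ∃ β : S.H₀ → ℂ, Summable (fun h => ‖β h‖ ^ 2) ∧
    (∀ x, HasSum (fun h : S.H₀ => (p : ℂ) * β h * φ (S.dil x - h)) (φ x)) ∧
    ∀ n : ℤ, Tendsto
      (fun T : Finset S.H₀ => eLpNorm
        (fun χ => m₀ χ - ∑ h ∈ T, β h * conj (charVal (S.charDil (-1) χ) h))
        2 (ν.restrict (S.ann n))) atTop (𝓝 0)

end

end ZeroDimGroup

noncomputable section

/-- The Fourier transform `f̂(χ) = ∫ f(x) conj (χ, x) dμ(x)` (used for integrable `f`). -/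
def fourierTr {G : Type*} [AddCommGroup G] [TopologicalSpace G] [MeasurableSpace G]
    (μ : Measure G) (f : G → ℂ) (χ : CharGroup G) : ℂ :=
  ∫ x, f x * conj (charVal χ x) ∂μ

/-- The inverse Fourier transform `x ↦ ∫ F(χ) (χ, x) dν(χ)` (used for integrable `F`). -/
def invFourierTr {G : Type*} [AddCommGroup G] [TopologicalSpace G]
    [MeasurableSpace (CharGroup G)] (ν : Measure (CharGroup G)) (F : CharGroup G → ℂ) (x : G) : ℂ :=
  ∫ χ, F χ * charVal χ x ∂ν

namespace ZeroDimGroup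

variable {G : Type*} [AddCommGroup G] [TopologicalSpace G] [IsTopologicalAddGroup G]
  {p : ℕ} (S : ZeroDimGroup G p)

/-- The function `ψ` generated by `φ` and a mask `m`: `ψ̂(χ) = φ̂(χ𝒜⁻¹) m(χ)`. -/
def wavelet [MeasurableSpace G] [MeasurableSpace (CharGroup G)]
    (μ : Measure G) (ν : Measure (CharGroup G)) (φ : G → ℂ) (m : CharGroup G → ℂ) : G → ℂ :=
  invFourierTr ν (fun χ => fourierTr μ φ (S.charDil (-1) χ) * m χ)

/-- `ψ_{n,h}(x) = p^{n/2} ψ(𝒜ⁿ x - h)`. -/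
def affine (ψ : G → ℂ) (n : ℤ) (h : G) (x : G) : ℂ :=
  (((p : ℝ) ^ ((n : ℝ) / 2) : ℝ) : ℂ) * ψ (S.dilPow n x - h)

end ZeroDimGroup

/-- A Parseval (tight) frame of a Hilbert space: `∑ |⟨f, eᵢ⟩|² = ‖f‖²` and `∑ ⟨f, eᵢ⟩ eᵢ = f`
for every `f`. -/
def IsParsevalFrame {ι H : Type*} [NormedAddCommGroup H] [InnerProductSpace ℂ H]
    (e : ι → H) : Prop :=
  ∀ f : H, HasSum (fun i => ‖inner ℂ (e i) f‖ ^ 2) (‖f‖ ^ 2) ∧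
    HasSum (fun i => inner ℂ (e i) f • e i) f

end

/-! Write `E_j` as the coset `ρ_j G_{-s}^⊥`, `s = s(j)`. The inverse transform of its indicator is
`p^{-s}` times the restriction of the character `ρ_j` to `G_{-s}` (`wavelet_eq_atom`). Dilating and
translating, `ψ^{(j)}_{n,h}` is a multiple of an atom: the character `ρ_j𝒜ⁿ` cut off to the ball
`𝒜⁻ⁿh + G_{n-s}`, with its argument measured from the centre (`atom_dilPow_sub`).

The system is an orthonormal basis with repetitions. The sets `E_j𝒜^{t(j)}` partition one annulus
`G_{M+1}^⊥ \ G_M^⊥`, so all dilates `E_j𝒜ⁿ` are pairwise disjoint and partition every annulus. Atoms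
over disjoint cosets are orthogonal (`inner_atomLp_of_disjoint`), atoms over one coset on different
balls have disjoint supports, and those on the same ball differ by a unimodular factor. Normalizing
one atom for each coset and ball thus gives an orthonormal system.

For totality (`eq_zero_of_inner_atomLp`), summing over the cosets in the annulus `G_{n+1}^⊥ \ G_n^⊥`
produces `p^{n+1} 1_{y+G_{n+1}} - pⁿ 1_{y+G_n}`. If `f` is orthogonal to all atoms, `pⁿ ∫_{y+G_n} f`
does not depend on `n`. By Cauchy–Schwarz it is at most `p^{n/2}‖f‖`, which tends to `0` as `n →
-∞`; so `f` integrates to zero over all balls and vanishes.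

Finally, `H₀` represents `G/G₀`, so each ball arises from exactly `p^s` translations `h`
(`card_H₀_fiber`), while `‖ψ^{(j)}_{n,h}‖² = p^{-s}`. The repetitions exactly compensate the norms
(`isParsevalFrame_of_fibers`). -/

set_option linter.unusedSectionVars false

/-! ### Algebra and continuity of character values -/

section CharVal

variable {G : Type*} [AddCommGroup G] [TopologicalSpace G]

theorem charVal_add (χ : CharGroup G) (x y : G) :
    charVal χ (x + y) = charVal χ x * charVal χ y := by
  simp [charVal, ofAdd_add]

theorem charVal_zero (χ : CharGroup G) : charVal χ 0 = 1 := by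
  simp [charVal]

theorem charVal_ne_zero (χ : CharGroup G) (x : G) : charVal χ x ≠ 0 := by
  simp [charVal]

theorem norm_charVal (χ : CharGroup G) (x : G) : ‖charVal χ x‖ = 1 :=
  Circle.norm_coe _

theorem charVal_mul (χ η : CharGroup G) (x : G) :
    charVal (χ * η) x = charVal χ x * charVal η x := by
  have : (χ * η) (Multiplicative.ofAdd x) =
    χ (Multiplicative.ofAdd x) * η (Multiplicative.ofAdd x) := rfl
  simp [charVal, this]

theorem charVal_one (x : G) : charVal (1 : CharGroup G) x = 1 := by
  simp [charVal]

theorem charVal_inv (χ : CharGroup G) (x : G) : charVal χ⁻¹ x = (charVal χ x)⁻¹ := by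
  refine eq_inv_of_mul_eq_one_left ?_
  rw [← charVal_mul, inv_mul_cancel, charVal_one]

theorem conj_charVal (χ : CharGroup G) (x : G) : conj (charVal χ x) = (charVal χ x)⁻¹ := by
  rw [Complex.inv_def, Complex.normSq_eq_norm_sq, norm_charVal]
  simp

theorem charVal_neg (χ : CharGroup G) (x : G) : charVal χ (-x) = (charVal χ x)⁻¹ := by
  refine eq_inv_of_mul_eq_one_left ?_
  rw [← charVal_add, neg_add_cancel, charVal_zero]

theorem charVal_sub (χ : CharGroup G) (x y : G) :
    charVal χ (x - y) = charVal χ x * (charVal χ y)⁻¹ := by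
  rw [sub_eq_add_neg, charVal_add, charVal_neg]

theorem charVal_nsmul (χ : CharGroup G) (a : ℕ) (x : G) :
    charVal χ (a • x) = charVal χ x ^ a := by
  induction a with
  | zero => simp [charVal_zero]
  | succ a ih => rw [succ_nsmul, charVal_add, ih, pow_succ]

theorem charVal_pow (χ : CharGroup G) (a : ℕ) (x : G) :
    charVal (χ ^ a) x = charVal χ x ^ a := by
  induction a with
  | zero => simp [charVal_one]
  | succ a ih => rw [pow_succ, charVal_mul, ih, pow_succ]

theorem charVal_ext {χ η : CharGroup G} (h : ∀ x, charVal χ x = charVal η x) : χ = η :=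
  PontryaginDual.ext fun a => Circle.ext (h a.toAdd)

theorem continuous_charVal (χ : CharGroup G) : Continuous (charVal χ) :=
  continuous_subtype_val.comp ((map_continuous χ).comp continuous_ofAdd)

theorem continuous_charVal_left (x : G) : Continuous fun χ : CharGroup G => charVal χ x :=
  continuous_subtype_val.comp
    (continuous_eval_const (F := Multiplicative G →ₜ* Circle) (Multiplicative.ofAdd x))

end CharVal

/-- If `B` is the disjoint union of `p` preimages of `A` under measure preserving operations, then
`μ B = p μ A`. -/
theorem measure_eq_mul_of_partition {α : Type*} [MeasurableSpace α] {μ : Measure α} {A B : Set α}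
    (p : ℕ) (T : ℕ → α → α) (hT : ∀ a, μ (T a ⁻¹' A) = μ A)
    (hm : ∀ a, MeasurableSet (T a ⁻¹' A))
    (hd : ∀ x, ∀ a < p, ∀ b < p, T a x ∈ A → T b x ∈ A → a = b)
    (hB : ∀ x, x ∈ B ↔ ∃ a < p, T a x ∈ A) : μ B = p * μ A := by
  have : B = ⋃ a ∈ Finset.range p, T a ⁻¹' A := by
    ext x; simp [hB]
  rw [this, measure_biUnion_finset _ (fun a _ => hm a)]
  · simp [hT]
  · intro a ha b hb hab
    refine Set.disjoint_left.2 fun x h1 h2 => hab (hd x a ?_ b ?_ h1 h2)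
    · simpa using ha
    · simpa using hb

theorem eq_zpow_of_step {p : ℝ} (hp : p ≠ 0) (u : ℤ → ℝ) (h0 : u 0 = 1)
    (hs : ∀ n, u (n + 1) = p * u n) (n : ℤ) : u n = p ^ n := by
  induction n with
  | zero => simpa using h0
  | succ i ih => rw [hs, ih, zpow_add_one₀ hp, mul_comm]
  | pred i ih =>
    have := hs (-(i : ℤ) - 1)
    rw [sub_add_cancel, ih] at this
    rw [zpow_sub_one₀ hp, this]
    field_simp

namespace ZeroDimGroup

/-! ### Digits and the Rademacher characters -/

section Chain

variable {G : Type*} [AddCommGroup G] [TopologicalSpace G] {p : ℕ} (S : ZeroDimGroup G p)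

/-- Integer coefficients are allowed because the lemma is applied to differences of two digits. -/
theorem eq_zero_of_zsmul_g_mem (n c : ℤ) (hc : |c| < p) (h : c • S.g n ∈ S.chain (n + 1)) :
    c = 0 := by
  by_contra h0
  refine S.smul_g_notMem n c.natAbs (by simpa using h0)
    (by rw [abs_lt] at hc; omega) ?_
  rcases Int.natAbs_eq c with hc' | hc'
  · rwa [hc', natCast_zsmul] at h
  · rw [hc', neg_zsmul, natCast_zsmul, neg_mem_iff] at h
    exact h

theorem digit_unique (n : ℤ) (x : G) (a b : ℕ) (ha : a < p) (hb : b < p)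
    (hxa : x - a • S.g n ∈ S.chain (n + 1)) (hxb : x - b • S.g n ∈ S.chain (n + 1)) : a = b := by
  have h := sub_mem hxa hxb
  have h2 : x - a • S.g n - (x - b • S.g n) = ((b : ℤ) - a) • S.g n := by
    rw [sub_zsmul, natCast_zsmul, natCast_zsmul]; abel
  rw [h2] at h
  have := S.eq_zero_of_zsmul_g_mem n _ (by rw [abs_lt]; omega) h
  omega

theorem p_smul_g_mem (n : ℤ) : p • S.g n ∈ S.chain (n + 1) := by
  set K := (S.chain (n + 1)).addSubgroupOf (S.chain n) with hK
  have hcard : Nat.card (S.chain n ⧸ K) = p := S.relIndex_chain n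
  have hpg : p • ((⟨S.g n, S.g_mem n⟩ : S.chain n) : S.chain n ⧸ K) = 0 := by
    have h := card_nsmul_eq_zero' (x := ((⟨S.g n, S.g_mem n⟩ : S.chain n) : S.chain n ⧸ K))
    rwa [hcard] at h
  have h2 : (((p • (⟨S.g n, S.g_mem n⟩ : S.chain n) : S.chain n)) : S.chain n ⧸ K) = 0 := hpg
  rw [QuotientAddGroup.eq_zero_iff, hK, AddSubgroup.mem_addSubgroupOf] at h2
  simpa using h2

theorem relIndex_chain_add (n : ℤ) (i : ℕ) :
    (S.chain (n + i)).relIndex (S.chain n) = p ^ i := by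
  induction i with
  | zero => simp
  | succ i ih =>
    rw [← AddSubgroup.relIndex_mul_relIndex _ (S.chain (n + i)) _ (S.chain_anti (by push_cast; omega))
      (S.chain_anti (by omega)), ih, pow_succ, mul_comm]
    congr 1
    have := S.relIndex_chain (n + i)
    rwa [add_assoc] at this

/-- Supplies the exact level `n < k` of `x`, at which the Rademacher character `r n` detects `x`. -/
theorem exists_notMem_succ (k : ℤ) (x : G) (hx : x ∉ S.chain k) :
    ∃ n < k, x ∈ S.chain n ∧ x ∉ S.chain (n + 1) := by
  obtain ⟨m, hm⟩ := S.exists_mem_chain x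
  by_contra! hcon
  have key : ∀ i : ℕ, m + i ≤ k → x ∈ S.chain (m + i) := by
    intro i
    induction i with
    | zero => intro _; simpa using hm
    | succ i ih =>
      intro hi
      push_cast at hi ⊢
      rw [← add_assoc]
      exact hcon _ (by omega) (ih (by omega))
  by_cases h : m ≤ k
  · have := key (k - m).toNat (by omega)
    rw [show m + ((k - m).toNat : ℤ) = k by omega] at this
    exact hx this
  · exact hx (S.chain_anti (by omega) hm)

theorem charVal_eq_of_sub_mem (n : ℤ) (χ : CharGroup G) (hχ : ∀ x ∈ S.chain n, charVal χ x = 1)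
    (x y : G) (h : x - y ∈ S.chain n) : charVal χ x = charVal χ y := by
  have := hχ _ h
  rw [charVal_sub] at this
  exact (mul_inv_eq_one₀ (charVal_ne_zero _ _)).1 this

theorem charVal_r_g_ne_one (n : ℤ) : charVal (S.r n) (S.g n) ≠ 1 := by
  intro h
  obtain ⟨x, hx, hx1⟩ := S.r_nontrivial n
  obtain ⟨a, _, ha⟩ := S.exists_digit n x hx
  refine hx1 ?_
  rw [S.charVal_eq_of_sub_mem (n + 1) _ (S.r_trivial n) _ _ ha, charVal_nsmul, h, one_pow]

theorem charVal_g_pow_p (n : ℤ) (χ : CharGroup G)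
    (hχ : ∀ x ∈ S.chain (n + 1), charVal χ x = 1) : charVal χ (S.g n) ^ p = 1 := by
  rw [← charVal_nsmul]
  exact hχ _ (S.p_smul_g_mem n)

theorem isPrimitiveRoot_charVal_r_g (n : ℤ) : IsPrimitiveRoot (charVal (S.r n) (S.g n)) p := by
  have : Fact p.Prime := ⟨S.prime⟩
  have h := orderOf_eq_prime (S.charVal_g_pow_p n _ (S.r_trivial n)) (S.charVal_r_g_ne_one n)
  have h2 := IsPrimitiveRoot.orderOf (charVal (S.r n) (S.g n))
  rwa [h] at h2

/-- Modulo the kernel, `x` is `a • g n` with a digit `0 < a < p`, and `(r n, g n)` is a primitive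
`p`-th root of unity. -/
theorem charVal_r_ne_one (n : ℤ) (x : G) (hx : x ∈ S.chain n) (hx' : x ∉ S.chain (n + 1)) :
    charVal (S.r n) x ≠ 1 := by
  obtain ⟨a, hap, ha⟩ := S.exists_digit n x hx
  rw [S.charVal_eq_of_sub_mem (n + 1) _ (S.r_trivial n) _ _ ha, charVal_nsmul]
  refine (S.isPrimitiveRoot_charVal_r_g n).pow_ne_one_of_pos_of_lt ?_ hap
  rintro rfl
  simp [hx'] at ha

end Chain

/-! ### Dilation of characters, annihilators and their cosets -/

section Dilation

variable {G : Type*} [AddCommGroup G] [TopologicalSpace G] [IsTopologicalAddGroup G]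
  {p : ℕ} (S : ZeroDimGroup G p)

theorem dilPow_mem_iff (k n : ℤ) (x : G) : S.dilPow k x ∈ S.chain n ↔ x ∈ S.chain (n + k) := by
  have hd : ∀ n x, S.dil x ∈ S.chain n ↔ x ∈ S.chain (n + 1) := fun n x =>
    ⟨fun h => S.mem_of_dil_mem _ _ (by simpa using h),
      fun h => by simpa using S.dil_mem _ _ h⟩
  -- Each step of the induction on `k` changes both `n` and `x`, so they must be generalized.
  suffices H : ∀ n x, S.dilPow k x ∈ S.chain n ↔ x ∈ S.chain (n + k) from H n x
  induction k with
  | zero => simp [S.dilPow_zero]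
  | succ i ih =>
    intro n x
    rw [S.dilPow_add_one, ih, hd, add_assoc]
  | pred i ih =>
    intro n x
    obtain ⟨y, rfl⟩ := S.dil.surjective x
    rw [← S.dilPow_add_one, hd, sub_add_cancel, ih]
    ring_nf

theorem dilPow_add (k l : ℤ) (x : G) : S.dilPow (k + l) x = S.dilPow k (S.dilPow l x) := by
  simp only [dilPow, add_zsmul]; rfl

theorem dilPow_dilPow_neg (k : ℤ) (x : G) : S.dilPow k (S.dilPow (-k) x) = x := by
  rw [← S.dilPow_add, add_neg_cancel, S.dilPow_zero]

theorem charDil_charDil (k l : ℤ) (χ : CharGroup G) :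
    S.charDil k (S.charDil l χ) = S.charDil (k + l) χ :=
  charVal_ext fun x => by rw [charVal_charDil, charVal_charDil, charVal_charDil, add_comm,
    S.dilPow_add]

theorem charDil_zero (χ : CharGroup G) : S.charDil 0 χ = χ :=
  charVal_ext fun x => by rw [charVal_charDil, S.dilPow_zero]

theorem charDil_mul (k : ℤ) (χ η : CharGroup G) :
    S.charDil k (χ * η) = S.charDil k χ * S.charDil k η :=
  charVal_ext fun x => by simp only [charVal_charDil, charVal_mul]

theorem charDil_inv (k : ℤ) (χ : CharGroup G) : S.charDil k χ⁻¹ = (S.charDil k χ)⁻¹ :=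
  charVal_ext fun x => by simp only [charVal_charDil, charVal_inv]

theorem mem_image_charDil (k : ℤ) (E : Set (CharGroup G)) (χ : CharGroup G) :
    χ ∈ S.charDil k '' E ↔ S.charDil (-k) χ ∈ E := by
  constructor
  · rintro ⟨η, h, rfl⟩
    rwa [S.charDil_charDil, neg_add_cancel, S.charDil_zero]
  · intro h
    exact ⟨_, h, by rw [S.charDil_charDil, add_neg_cancel, S.charDil_zero]⟩

theorem mul_mem_ann {n : ℤ} {χ η : CharGroup G} (h : χ ∈ S.ann n) (h' : η ∈ S.ann n) :
    χ * η ∈ S.ann n := fun x hx => by rw [charVal_mul, h x hx, h' x hx, one_mul]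

theorem one_mem_ann (n : ℤ) : (1 : CharGroup G) ∈ S.ann n := fun x _ => charVal_one x

theorem inv_mem_ann {n : ℤ} {χ : CharGroup G} (h : χ ∈ S.ann n) : χ⁻¹ ∈ S.ann n :=
  fun x hx => by rw [charVal_inv, h x hx, inv_one]

theorem ann_mono {m n : ℤ} (h : m ≤ n) : S.ann m ⊆ S.ann n :=
  fun _ hχ x hx => hχ x (S.chain_anti h hx)

theorem charDil_mem_ann (k n : ℤ) (χ : CharGroup G) :
    S.charDil k χ ∈ S.ann n ↔ χ ∈ S.ann (n - k) := by
  constructor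
  · intro h x hx
    have := h (S.dilPow (-k) x) (by rwa [S.dilPow_mem_iff])
    rwa [charVal_charDil, S.dilPow_dilPow_neg] at this
  · intro h x hx
    rw [charVal_charDil]
    exact h _ (by rwa [S.dilPow_mem_iff, sub_add_cancel])

theorem isClosed_ann (n : ℤ) : IsClosed (S.ann n) := by
  have : S.ann n = ⋂ x ∈ S.chain n, {χ | charVal χ x = 1} := by
    ext χ; simp [ann]
  rw [this]
  exact isClosed_biInter fun x _ => isClosed_eq (continuous_charVal_left x) continuous_const

/-- The coset `Gₖ^⊥ ρ`. -/
def annCoset (ρ : CharGroup G) (k : ℤ) : Set (CharGroup G) := {χ | ρ⁻¹ * χ ∈ S.ann k}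

theorem self_mem_annCoset (ρ : CharGroup G) (k : ℤ) : ρ ∈ S.annCoset ρ k := by
  simpa [annCoset] using S.one_mem_ann k

theorem isClosed_annCoset (ρ : CharGroup G) (k : ℤ) : IsClosed (S.annCoset ρ k) :=
  (S.isClosed_ann k).preimage (continuous_const_mul ρ⁻¹)

theorem coset_eq_annCoset (s M : ℕ) (α : ℤ → Fin p) :
    S.coset s M α =
      S.annCoset (∏ k ∈ Finset.Icc (-(s : ℤ)) (M : ℤ), S.r k ^ (α k : ℕ)) (-(s : ℤ)) := by
  ext χ
  constructor
  · rintro ⟨η, hη, rfl⟩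
    simpa [annCoset, mul_comm η] using hη
  · intro h
    exact ⟨_, h, by rw [mul_comm, mul_inv_cancel_left]⟩

theorem image_annCoset (t : ℤ) (ρ : CharGroup G) (k : ℤ) :
    S.charDil t '' S.annCoset ρ k = S.annCoset (S.charDil t ρ) (k + t) := by
  ext χ
  rw [S.mem_image_charDil, annCoset, annCoset, Set.mem_ofPred_eq, Set.mem_ofPred_eq,
    ← S.charDil_inv]
  rw [show k = k + t - t by ring, ← S.charDil_mem_ann, S.charDil_mul, S.charDil_charDil,
    add_neg_cancel, S.charDil_zero]
  ring_nf

theorem image_charDil_annulus (t k : ℤ) :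
    S.charDil t '' (S.ann (k + 1) \ S.ann k) = S.ann (k + t + 1) \ S.ann (k + t) := by
  ext χ
  rw [S.mem_image_charDil, Set.mem_sdiff, Set.mem_sdiff, S.charDil_mem_ann, S.charDil_mem_ann]
  ring_nf

/-- The dual digit expansion: `(χ, g n)` is a `p`-th root of unity, hence equals `(r n, g n)^a`, and
dividing `χ` by `r n ^ a` makes it trivial on `g n` and therefore on `G_n`. -/
theorem mem_ann_succ_iff (n : ℤ) (χ : CharGroup G) :
    χ ∈ S.ann (n + 1) ↔ ∃ a < p, (S.r n ^ a)⁻¹ * χ ∈ S.ann n := by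
  have hr : ∀ a, S.r n ^ a ∈ S.ann (n + 1) := fun a x hx => by
    rw [charVal_pow, S.r_trivial n x hx, one_pow]
  have : NeZero p := ⟨S.prime.ne_zero⟩
  constructor
  · intro h
    obtain ⟨a, ha, hx⟩ := (S.isPrimitiveRoot_charVal_r_g n).eq_pow_of_pow_eq_one
      (S.charVal_g_pow_p n χ h)
    refine ⟨a, ha, fun x hx' => ?_⟩
    obtain ⟨b, _, hb⟩ := S.exists_digit n x hx'
    rw [S.charVal_eq_of_sub_mem (n + 1) _ (S.mul_mem_ann (S.inv_mem_ann (hr a)) h) _ _ hb,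
      charVal_nsmul, charVal_mul, charVal_inv, charVal_pow, hx,
      inv_mul_cancel₀ (charVal_ne_zero _ _), one_pow]
  · rintro ⟨a, _, h⟩
    have := S.mul_mem_ann (hr a) (S.ann_mono (show n ≤ n + 1 by omega) h)
    rwa [mul_inv_cancel_left] at this

theorem ann_digit_unique (n : ℤ) (χ : CharGroup G) (a b : ℕ) (ha : a < p) (hb : b < p)
    (h1 : (S.r n ^ a)⁻¹ * χ ∈ S.ann n) (h2 : (S.r n ^ b)⁻¹ * χ ∈ S.ann n) : a = b := by
  have h3 := h1 _ (S.g_mem n)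
  have h4 := h2 _ (S.g_mem n)
  rw [charVal_mul, charVal_inv, charVal_pow, inv_mul_eq_one₀ (pow_ne_zero _ (charVal_ne_zero _ _))]
    at h3 h4
  exact (S.isPrimitiveRoot_charVal_r_g n).pow_inj ha hb (h3.trans h4.symm)

end Dilation

/-! ### Haar measure of the chains and integrals of characters -/

section Measure

variable {G : Type*} [AddCommGroup G] [TopologicalSpace G] [IsTopologicalAddGroup G]
  {p : ℕ} (S : ZeroDimGroup G p)

section Group

variable [MeasurableSpace G] [BorelSpace G]

theorem measurableSet_chain (n : ℤ) : MeasurableSet (S.chain n : Set G) :=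
  (S.isOpen_chain n).measurableSet

theorem measure_chain (μ : Measure G) [μ.IsAddHaarMeasure] (n : ℤ) :
    μ (S.chain n : Set G) = p * μ (S.chain (n + 1) : Set G) := by
  refine measure_eq_mul_of_partition p (fun a x => -(a • S.g n) + x)
    (fun a => measure_preimage_add _ _ _)
    (fun a => (measurable_const_add _) (S.measurableSet_chain _)) ?_ ?_
  · intro x a ha b hb h1 h2
    refine S.digit_unique n x a b ha hb ?_ ?_
    · simpa [sub_eq_neg_add] using h1
    · simpa [sub_eq_neg_add] using h2
  · intro x
    constructor
    · intro hx
      obtain ⟨a, ha, h⟩ := S.exists_digit n x hx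
      exact ⟨a, ha, by simpa [sub_eq_neg_add] using h⟩
    · rintro ⟨a, _, h⟩
      have := add_mem (S.chain_succ_le n h) (nsmul_mem (S.g_mem n) a)
      simpa using this

theorem measureReal_chain (μ : Measure G) [μ.IsAddHaarMeasure]
    (hμ : μ (S.chain 0 : Set G) = 1) (n : ℤ) : μ.real (S.chain n : Set G) = (p : ℝ) ^ (-n) := by
  have := eq_zpow_of_step (p := p) (by exact_mod_cast S.prime.ne_zero)
    (fun n => μ.real (S.chain (-n) : Set G)) (by simp [Measure.real, hμ]) (fun n => by
      rw [Measure.real, S.measure_chain μ, Measure.real, ENNReal.toReal_mul,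
        ENNReal.toReal_natCast]
      ring_nf) (-n)
  simpa using this

theorem measure_chain_ne_top (μ : Measure G) [μ.IsAddHaarMeasure]
    (hμ : μ (S.chain 0 : Set G) = 1) (n : ℤ) : μ (S.chain n : Set G) ≠ ∞ := by
  intro h
  have := S.measureReal_chain μ hμ n
  rw [Measure.real, h, ENNReal.toReal_top] at this
  exact zpow_ne_zero _ (by exact_mod_cast S.prime.ne_zero) this.symm

/-- Translating by some `y ∈ G_k` with `(χ, y) ≠ 1` preserves the integral but multiplies it by `(χ,
y)`. -/
theorem setIntegral_chain_charVal (μ : Measure G) [μ.IsAddHaarMeasure] (χ : CharGroup G) (k : ℤ)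
    (h : χ ∉ S.ann k) : ∫ x in (S.chain k : Set G), charVal χ x ∂μ = 0 := by
  simp only [ann, Set.mem_ofPred_eq, not_forall] at h
  obtain ⟨y, hy, hy1⟩ := h
  rw [← integral_indicator (S.measurableSet_chain k)]
  set I := ∫ x, (S.chain k : Set G).indicator (charVal χ) x ∂μ with hI
  have : charVal χ y * I = I := by
    conv_rhs => rw [hI, ← integral_add_left_eq_self _ y]
    rw [hI, ← integral_const_mul]
    congr 1
    funext x
    by_cases hx : x ∈ S.chain k
    · have := add_mem hy hx
      simp [hx, this, charVal_add]
    · have : y + x ∉ S.chain k := fun h => hx ((AddSubgroup.add_mem_cancel_left _ hy).1 h)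
      simp [hx, this]
  have h2 : (charVal χ y - 1) * I = 0 := by rw [sub_mul, this]; ring
  exact (mul_eq_zero.1 h2).resolve_left (sub_ne_zero.2 hy1)

end Group

section Dual

variable [MeasurableSpace (CharGroup G)] [BorelSpace (CharGroup G)]

theorem measurableSet_ann (n : ℤ) : MeasurableSet (S.ann n) := (S.isClosed_ann n).measurableSet

theorem measurableSet_annCoset (ρ : CharGroup G) (n : ℤ) : MeasurableSet (S.annCoset ρ n) :=
  (S.isClosed_annCoset ρ n).measurableSet

variable (ν : Measure (CharGroup G)) [ν.IsHaarMeasure]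

theorem measure_ann_succ (n : ℤ) : ν (S.ann (n + 1)) = p * ν (S.ann n) :=
  measure_eq_mul_of_partition p (fun a χ => (S.r n ^ a)⁻¹ * χ)
    (fun _ => measure_preimage_mul _ _ _)
    (fun _ => (measurable_const_mul _) (S.measurableSet_ann _))
    (fun χ a ha b hb h1 h2 => S.ann_digit_unique n χ a b ha hb h1 h2)
    (fun χ => S.mem_ann_succ_iff n χ)

theorem measureReal_ann (hν : ν (S.ann 0) = 1) (n : ℤ) : ν.real (S.ann n) = (p : ℝ) ^ n :=
  eq_zpow_of_step (p := p) (by exact_mod_cast S.prime.ne_zero)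
    (fun n => ν.real (S.ann n)) (by simp [Measure.real, hν]) (fun n => by
      rw [Measure.real, S.measure_ann_succ ν, Measure.real, ENNReal.toReal_mul,
        ENNReal.toReal_natCast]) n

theorem measure_ann_ne_top (hν : ν (S.ann 0) = 1) (n : ℤ) : ν (S.ann n) ≠ ∞ := by
  intro h
  have := S.measureReal_ann ν hν n
  rw [Measure.real, h, ENNReal.toReal_top] at this
  exact zpow_ne_zero _ (by exact_mod_cast S.prime.ne_zero) this.symm

theorem measure_annCoset (ρ : CharGroup G) (n : ℤ) : ν (S.annCoset ρ n) = ν (S.ann n) :=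
  measure_preimage_mul ν ρ⁻¹ (S.ann n)

theorem integrableOn_charVal (hν : ν (S.ann 0) = 1) (ρ : CharGroup G) (n : ℤ) (x : G) :
    IntegrableOn (fun χ => charVal χ x) (S.annCoset ρ n) ν := by
  refine Measure.integrableOn_of_bounded (M := 1) ?_
    (continuous_charVal_left x).aestronglyMeasurable
    (Eventually.of_forall fun χ => (norm_charVal χ x).le)
  rw [S.measure_annCoset]
  exact S.measure_ann_ne_top ν hν n

/-- For `x ∉ G_k` the integral is killed by translation with `r n`, where `n < k` is the level of
`x`: this character lies in `G_k^⊥` and is not `1` at `x`. -/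
theorem setIntegral_ann_charVal (hν : ν (S.ann 0) = 1) (k : ℤ) (x : G) :
    ∫ χ in S.ann k, charVal χ x ∂ν = (S.chain k : Set G).indicator (fun _ => (p : ℂ) ^ k) x := by
  by_cases hx : x ∈ S.chain k
  · rw [Set.indicator_of_mem hx, setIntegral_congr_fun (g := fun _ => (1 : ℂ))
      (S.measurableSet_ann k) (fun χ hχ => hχ x hx)]
    simp [S.measureReal_ann ν hν]
  · rw [Set.indicator_of_notMem hx]
    obtain ⟨n, hn, h1, h2⟩ := S.exists_notMem_succ k x hx
    have hr : S.r n ∈ S.ann k := S.ann_mono (by omega) (S.r_trivial n)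
    rw [← integral_indicator (S.measurableSet_ann k)]
    set I := ∫ χ, (S.ann k).indicator (fun χ => charVal χ x) χ ∂ν with hI
    have : charVal (S.r n) x * I = I := by
      conv_rhs => rw [hI, ← integral_mul_left_eq_self _ (S.r n)]
      rw [hI, ← integral_const_mul]
      congr 1
      funext χ
      by_cases hχ : χ ∈ S.ann k
      · have := S.mul_mem_ann hr hχ
        simp [hχ, this, charVal_mul]
      · have : S.r n * χ ∉ S.ann k := fun h => hχ (by
          simpa using S.mul_mem_ann (S.inv_mem_ann hr) h)
        simp [hχ, this]
    have h3 : (charVal (S.r n) x - 1) * I = 0 := by rw [sub_mul, this]; ring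
    exact (mul_eq_zero.1 h3).resolve_left (sub_ne_zero.2 (S.charVal_r_ne_one n x h1 h2))

theorem setIntegral_annCoset_charVal (hν : ν (S.ann 0) = 1) (ρ : CharGroup G) (k : ℤ) (x : G) :
    ∫ χ in S.annCoset ρ k, charVal χ x ∂ν =
      (p : ℂ) ^ k * (S.chain k : Set G).indicator (charVal ρ) x := by
  rw [← integral_indicator (S.measurableSet_annCoset ρ k), ← integral_mul_left_eq_self _ ρ]
  have : (fun χ => (S.annCoset ρ k).indicator (fun χ => charVal χ x) (ρ * χ)) =
      fun χ => charVal ρ x * (S.ann k).indicator (fun χ => charVal χ x) χ := by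
    funext χ
    by_cases hχ : χ ∈ S.ann k <;> simp [Set.indicator, annCoset, hχ, charVal_mul]
  rw [this, integral_const_mul, integral_indicator (S.measurableSet_ann k),
    S.setIntegral_ann_charVal ν hν]
  by_cases hx : x ∈ S.chain k <;> simp [hx, mul_comm]

end Dual

end Measure

end ZeroDimGroup

/-! ### Parseval frames in an abstract Hilbert space -/

section Frames

variable {ι κ H : Type*} [NormedAddCommGroup H] [InnerProductSpace ℂ H]

/-- With `w` the partial sum, expand `⟨w, w⟩` and apply `ab ≤ (a² + b²)/2` to each term. By the
Parseval identity for `w`, the terms `‖⟨u i, w⟩‖²` contribute at most `‖w‖²/2`, which is absorbed on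
the left. -/
theorem norm_sq_sum_inner_smul_le {u : ι → H}
    (hu : ∀ f, HasSum (fun i => ‖inner ℂ (u i) f‖ ^ 2) (‖f‖ ^ 2)) (f : H) (T : Finset ι) :
    ‖∑ i ∈ T, inner ℂ (u i) f • u i‖ ^ 2 ≤ ∑ i ∈ T, ‖inner ℂ (u i) f‖ ^ 2 := by
  set w := ∑ i ∈ T, inner ℂ (u i) f • u i with hw
  have h1 : ‖w‖ ^ 2 ≤ ∑ i ∈ T, (‖inner ℂ (u i) f‖ ^ 2 + ‖inner ℂ (u i) w‖ ^ 2) / 2 := by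
    have h2 : ‖w‖ ^ 2 = ‖inner ℂ w w‖ := by
      rw [inner_self_eq_norm_sq_to_K]; simp
    rw [h2]
    conv_lhs => rw [hw]
    rw [sum_inner]
    refine (norm_sum_le _ _).trans (Finset.sum_le_sum fun i _ => ?_)
    rw [inner_smul_left, norm_mul, RCLike.norm_conj]
    nlinarith [sq_nonneg (‖inner ℂ (u i) f‖ - ‖inner ℂ (u i) w‖)]
  have h3 : ∑ i ∈ T, ‖inner ℂ (u i) w‖ ^ 2 ≤ ‖w‖ ^ 2 :=
    sum_le_hasSum T (fun i _ => sq_nonneg _) (hu w)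
  rw [← Finset.sum_div, Finset.sum_add_distrib] at h1
  linarith

/-- The Parseval identity implies the reconstruction formula. -/
theorem isParsevalFrame_of_hasSum {u : ι → H}
    (hu : ∀ f, HasSum (fun i => ‖inner ℂ (u i) f‖ ^ 2) (‖f‖ ^ 2)) : IsParsevalFrame u := by
  intro f
  refine ⟨hu f, ?_⟩
  -- On expanding the square, the cross term is minus twice the partial sum of squares, while the
  -- square of the synthesized vector costs at most one such sum.
  have hle : ∀ T : Finset ι, ‖∑ i ∈ T, inner ℂ (u i) f • u i - f‖ ^ 2 ≤
      ‖f‖ ^ 2 - ∑ i ∈ T, ‖inner ℂ (u i) f‖ ^ 2 := by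
    intro T
    have h1 := norm_sq_sum_inner_smul_le hu f T
    have h2 : RCLike.re (inner ℂ (∑ i ∈ T, inner ℂ (u i) f • u i) f) =
        ∑ i ∈ T, ‖inner ℂ (u i) f‖ ^ 2 := by
      rw [sum_inner, map_sum]
      refine Finset.sum_congr rfl fun i _ => ?_
      rw [inner_smul_left, RCLike.conj_mul]
      norm_cast
    rw [norm_sub_sq (𝕜 := ℂ), h2]
    linarith
  have h0 : Tendsto (fun T : Finset ι => ‖f‖ ^ 2 - ∑ i ∈ T, ‖inner ℂ (u i) f‖ ^ 2) atTop (𝓝 0) := by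
    have h := hu f
    rw [HasSum, SummationFilter.unconditional_filter] at h
    rw [← sub_self (‖f‖ ^ 2)]
    exact h.const_sub _
  have h1 := squeeze_zero (fun T => sq_nonneg _) hle h0
  rw [HasSum, SummationFilter.unconditional_filter, tendsto_iff_norm_sub_tendsto_zero]
  have h2 := h1.sqrt
  simpa [Real.sqrt_sq] using h2

/-- Over each `i` there are `N i` equal terms `g i / N i`, so summing along the fibers of `π` first
returns `g i`. -/
theorem hasSum_of_fibers {f : κ → ℝ} {g : ι → ℝ} {a : ℝ} (π : κ → ι) (N : ι → ℕ)
    (hN : ∀ i, N i ≠ 0) (hcard : ∀ i, Nat.card {k // π k = i} = N i) (hg : ∀ i, 0 ≤ g i)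
    (hf : ∀ k, (N (π k) : ℝ) * f k = g (π k)) (h : HasSum g a) : HasSum f a := by
  have hN' : ∀ i, (N i : ℝ) ≠ 0 := fun i => by exact_mod_cast hN i
  have hf' : ∀ k, f k = g (π k) / N (π k) := fun k => by
    rw [eq_div_iff (hN' _), mul_comm, hf]
  rw [← (Equiv.sigmaFiberEquiv π).hasSum_iff]
  have hfib : ∀ i, HasSum (fun k : {k // π k = i} => f k) (g i) := by
    intro i
    have : Finite {k // π k = i} := Nat.finite_of_card_ne_zero (by rw [hcard]; exact hN i)
    have : Fintype {k // π k = i} := Fintype.ofFinite _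
    convert hasSum_fintype (fun k : {k // π k = i} => f k) using 1
    have h1 : ∀ k : {k // π k = i}, f k = g i / N i := fun k => by rw [hf', k.2]
    rw [Finset.sum_congr rfl fun k _ => h1 k, Finset.sum_const, Finset.card_univ,
      ← Nat.card_eq_fintype_card, hcard, nsmul_eq_mul, mul_div_cancel₀ _ (hN' i)]
  refine HasSum.sigma_of_hasSum h hfib ?_
  refine (summable_sigma_of_nonneg fun x => ?_).2 ⟨fun i => (hfib i).summable, ?_⟩
  · show 0 ≤ f _
    rw [hf']
    exact div_nonneg (hg _) (Nat.cast_nonneg _)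
  · exact h.summable.congr fun i => ((hfib i).tsum_eq).symm

/-- A system that repeats the members of an orthonormal basis, up to factors that compensate for the
number of repetitions, is a Parseval frame. -/
theorem isParsevalFrame_of_fibers [CompleteSpace H] {e : ι → H} (he : Orthonormal ℂ e)
    (hc : ∀ f, (∀ i, inner ℂ (e i) f = 0) → f = 0) {u : κ → H} (π : κ → ι) (N : ι → ℕ)
    (hN : ∀ i, N i ≠ 0) (hcard : ∀ i, Nat.card {k // π k = i} = N i)
    (hu : ∀ k f, (N (π k) : ℝ) * ‖inner ℂ (u k) f‖ ^ 2 = ‖inner ℂ (e (π k)) f‖ ^ 2) :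
    IsParsevalFrame u := by
  have hbot : (Submodule.span ℂ (Set.range e))ᗮ = ⊥ := by
    rw [Submodule.eq_bot_iff]
    intro f hf
    exact hc f fun i => hf _ (Submodule.subset_span ⟨i, rfl⟩)
  let b := HilbertBasis.mkOfOrthogonalEqBot he hbot
  have hb : ∀ i, b i = e i := fun i => by simp [b]
  refine isParsevalFrame_of_hasSum fun f => ?_
  refine hasSum_of_fibers (g := fun i => ‖inner ℂ (e i) f‖ ^ 2) π N hN hcard
    (fun i => sq_nonneg _) (fun k => hu k f) ?_
  have h := Complex.hasSum_re (b.hasSum_inner_mul_inner f f)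
  convert h using 1
  · funext i
    rw [hb, ← RCLike.re_eq_complex_re, inner_mul_symm_re_eq_norm, norm_mul, norm_inner_symm f, sq]
  · rw [inner_self_eq_norm_sq_to_K]
    norm_cast

end Frames

namespace ZeroDimGroup

/-! ### Atoms: characters cut off to balls, and their inner products -/

section Atoms

variable {G : Type*} [AddCommGroup G] [TopologicalSpace G] [IsTopologicalAddGroup G]
  {p : ℕ} (S : ZeroDimGroup G p)

/-- The coset `y + Gₖ`. -/
def ball (y : G) (k : ℤ) : Set G := {x | x - y ∈ S.chain k}

/-- The restriction of the translated character `x ↦ (ρ, x - y)` to `y + Gₖ`. -/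
noncomputable def atom (ρ : CharGroup G) (k : ℤ) (y x : G) : ℂ :=
  (S.chain k : Set G).indicator (charVal ρ) (x - y)

theorem atom_eq_indicator (ρ : CharGroup G) (k : ℤ) (y : G) :
    S.atom ρ k y = (S.ball y k).indicator fun x => charVal ρ (x - y) := by
  funext x
  by_cases h : x - y ∈ S.chain k <;> simp [atom, ball, Set.indicator, h]

theorem atom_add_left (ρ : CharGroup G) (k : ℤ) (y x : G) :
    S.atom ρ k y (y + x) = (S.chain k : Set G).indicator (charVal ρ) x := by
  simp [atom]

/-- The reason why different translations `h` repeat the same basis vector: moving the centre inside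
the ball costs only a unimodular factor. -/
theorem atom_eq_mul_atom (ρ : CharGroup G) (k : ℤ) {y y' : G} (h : y - y' ∈ S.chain k) (x : G) :
    S.atom ρ k y x = charVal ρ (y' - y) * S.atom ρ k y' x := by
  have hiff : x - y ∈ S.chain k ↔ x - y' ∈ S.chain k := by
    rw [← AddSubgroup.add_mem_cancel_right _ h, sub_add_sub_cancel]
  by_cases hx : x - y' ∈ S.chain k
  · have hx' := hiff.2 hx
    simp only [atom, Set.indicator, SetLike.mem_coe, hx, hx', if_true, ← charVal_add]
    congr 1
    abel
  · have hx' : x - y ∉ S.chain k := fun h => hx (hiff.1 h)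
    simp [atom, hx, hx']

theorem isOpen_ball (y : G) (k : ℤ) : IsOpen (S.ball y k) :=
  (S.isOpen_chain k).preimage (continuous_sub_right y)

theorem mem_ball_self (y : G) (k : ℤ) : y ∈ S.ball y k := by simp [ball, zero_mem]

theorem ball_subset_ball {x y y' : G} {k k' : ℤ} (hk : k' ≤ k) (hx : x ∈ S.ball y k)
    (hx' : x ∈ S.ball y' k') : S.ball y k ⊆ S.ball y' k' := by
  intro z hz
  have h1 := S.chain_anti hk (sub_mem hz hx)
  have := add_mem h1 hx'
  simpa [ball] using this

variable [MeasurableSpace G] [BorelSpace G]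

theorem measurableSet_ball (y : G) (k : ℤ) : MeasurableSet (S.ball y k) :=
  (S.isOpen_ball y k).measurableSet

variable (μ : Measure G) [μ.IsAddHaarMeasure]

theorem measure_ball (y : G) (k : ℤ) : μ (S.ball y k) = μ (S.chain k : Set G) := by
  have : S.ball y k = (fun x => -y + x) ⁻¹' (S.chain k : Set G) := by
    ext x; simp [ball, sub_eq_neg_add]
  rw [this, measure_preimage_add]

theorem memLp_atom (hμ : μ (S.chain 0 : Set G) = 1) (ρ : CharGroup G) (k : ℤ) (y : G) :
    MemLp (S.atom ρ k y) 2 μ := by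
  rw [S.atom_eq_indicator, memLp_indicator_iff_restrict (S.measurableSet_ball y k)]
  have : IsFiniteMeasure (μ.restrict (S.ball y k)) :=
    isFiniteMeasure_restrict.2 (by rw [S.measure_ball]; exact S.measure_chain_ne_top μ hμ k)
  exact MemLp.of_bound
    ((continuous_charVal ρ).comp (continuous_sub_right y)).aestronglyMeasurable 1
    (Eventually.of_forall fun x => (norm_charVal _ _).le)

variable (hμ : μ (S.chain 0 : Set G) = 1)

/-- The class of an atom in `L²`. -/
noncomputable def atomLp (ρ : CharGroup G) (k : ℤ) (y : G) : Lp ℂ 2 μ :=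
  (S.memLp_atom μ hμ ρ k y).toLp

theorem inner_atomLp (ρ : CharGroup G) (k : ℤ) (y : G) (f : Lp ℂ 2 μ) :
    inner ℂ (S.atomLp μ hμ ρ k y) f = ∫ x, conj (S.atom ρ k y x) * f x ∂μ := by
  rw [L2.inner_def]
  refine integral_congr_ae ?_
  filter_upwards [(S.memLp_atom μ hμ ρ k y).coeFn_toLp] with x hx
  rw [atomLp, hx, RCLike.inner_apply, mul_comm]

theorem integrable_atom_mul (hμ : μ (S.chain 0 : Set G) = 1) (ρ : CharGroup G) (k : ℤ) (y : G) (f : Lp ℂ 2 μ) :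
    Integrable (fun x => conj (S.atom ρ k y x) * f x) μ := by
  refine (L2.integrable_inner (𝕜 := ℂ) (S.atomLp μ hμ ρ k y) f).congr ?_
  filter_upwards [(S.memLp_atom μ hμ ρ k y).coeFn_toLp] with x hx
  rw [atomLp, hx, RCLike.inner_apply, mul_comm]

theorem inner_atomLp_atomLp (ρ ρ' : CharGroup G) (k k' : ℤ) (y y' : G) :
    inner ℂ (S.atomLp μ hμ ρ k y) (S.atomLp μ hμ ρ' k' y') =
      ∫ x, conj (S.atom ρ k y x) * S.atom ρ' k' y' x ∂μ := by
  rw [S.inner_atomLp]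
  refine integral_congr_ae ?_
  filter_upwards [(S.memLp_atom μ hμ ρ' k' y').coeFn_toLp] with x hx
  rw [atomLp, hx]

theorem atomLp_eq_smul (ρ : CharGroup G) (k : ℤ) {y y' : G} (h : y - y' ∈ S.chain k) :
    S.atomLp μ hμ ρ k y = charVal ρ (y' - y) • S.atomLp μ hμ ρ k y' := by
  rw [atomLp, atomLp, ← MemLp.toLp_const_smul]
  congr 1
  funext x
  exact S.atom_eq_mul_atom ρ k h x

theorem norm_inner_atomLp_eq (ρ : CharGroup G) (k : ℤ) {y y' : G} (h : y - y' ∈ S.chain k)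
    (f : Lp ℂ 2 μ) :
    ‖inner ℂ (S.atomLp μ hμ ρ k y) f‖ = ‖inner ℂ (S.atomLp μ hμ ρ k y') f‖ := by
  rw [S.atomLp_eq_smul μ hμ ρ k h, inner_smul_left, norm_mul, RCLike.norm_conj, norm_charVal,
    one_mul]

theorem inner_atomLp_self (ρ : CharGroup G) (k : ℤ) (y : G) :
    inner ℂ (S.atomLp μ hμ ρ k y) (S.atomLp μ hμ ρ k y) = (p : ℂ) ^ (-k) := by
  rw [S.inner_atomLp_atomLp]
  have : (fun x => conj (S.atom ρ k y x) * S.atom ρ k y x) = (S.ball y k).indicator fun _ => 1 := by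
    funext x
    rw [S.atom_eq_indicator]
    by_cases hx : x ∈ S.ball y k
    · simp [hx, conj_charVal, charVal_ne_zero]
    · simp [hx]
  rw [this, integral_indicator (S.measurableSet_ball y k)]
  simp only [integral_const, MeasurableSet.univ, measureReal_restrict_apply, Set.univ_inter]
  rw [Measure.real, S.measure_ball, ← Measure.real, S.measureReal_chain μ hμ]
  simp

theorem norm_sq_atomLp (ρ : CharGroup G) (k : ℤ) (y : G) :
    ‖S.atomLp μ hμ ρ k y‖ ^ 2 = (p : ℝ) ^ (-k) := by
  have := S.inner_atomLp_self μ hμ ρ k y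
  rw [inner_self_eq_norm_sq_to_K] at this
  refine Complex.ofReal_injective ?_
  push_cast
  exact this

theorem inner_atomLp_of_disjoint_ball (ρ ρ' : CharGroup G) {k k' : ℤ} {y y' : G}
    (h : Disjoint (S.ball y k) (S.ball y' k')) :
    inner ℂ (S.atomLp μ hμ ρ k y) (S.atomLp μ hμ ρ' k' y') = 0 := by
  rw [S.inner_atomLp_atomLp]
  refine integral_eq_zero_of_ae (Eventually.of_forall fun x => ?_)
  rw [S.atom_eq_indicator, S.atom_eq_indicator]
  by_cases hx : x ∈ S.ball y k
  · simp [Set.disjoint_left.1 h hx]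
  · simp [hx]

/-- If the balls meet, the smaller one `y + G_k` lies inside the other, and up to a constant the
inner product is the integral of `ρ⁻¹ρ'` over `G_k`. It vanishes because disjointness of the cosets
prevents `ρ'` from lying in `ρ G_k^⊥`. -/
theorem inner_atomLp_of_disjoint_of_le (ρ ρ' : CharGroup G) {k k' : ℤ} (y y' : G) (hk : k' ≤ k)
    (h : Disjoint (S.annCoset ρ k) (S.annCoset ρ' k')) :
    inner ℂ (S.atomLp μ hμ ρ k y) (S.atomLp μ hμ ρ' k' y') = 0 := by
  by_cases hd : Disjoint (S.ball y k) (S.ball y' k')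
  · exact S.inner_atomLp_of_disjoint_ball μ hμ ρ ρ' hd
  obtain ⟨z, hz, hz'⟩ := Set.not_disjoint_iff.1 hd
  have hsub := S.ball_subset_ball hk hz hz'
  have hnot : ρ⁻¹ * ρ' ∉ S.ann k := fun hc =>
    Set.disjoint_left.1 h (show ρ' ∈ S.annCoset ρ k from hc) (S.self_mem_annCoset ρ' k')
  rw [S.inner_atomLp_atomLp, ← integral_add_left_eq_self _ y]
  have : (fun x => conj (S.atom ρ k y (y + x)) * S.atom ρ' k' y' (y + x)) =
      fun x => charVal ρ' (y - y') * (S.chain k : Set G).indicator (charVal (ρ⁻¹ * ρ')) x := by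
    funext x
    rw [S.atom_add_left, S.atom_eq_indicator]
    by_cases hx : x ∈ S.chain k
    · have h2 : y + x ∈ S.ball y' k' := hsub (by simpa [ball] using hx)
      rw [Set.indicator_of_mem hx, Set.indicator_of_mem h2, Set.indicator_of_mem hx, conj_charVal,
        charVal_mul, charVal_inv, add_sub_right_comm, charVal_add]
      ring
    · simp [hx]
  rw [this, integral_const_mul, integral_indicator (S.measurableSet_chain k),
    S.setIntegral_chain_charVal μ _ k hnot, mul_zero]

theorem inner_atomLp_of_disjoint (ρ ρ' : CharGroup G) {k k' : ℤ} (y y' : G)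
    (h : Disjoint (S.annCoset ρ k) (S.annCoset ρ' k')) :
    inner ℂ (S.atomLp μ hμ ρ k y) (S.atomLp μ hμ ρ' k' y') = 0 := by
  rcases le_total k' k with hk | hk
  · exact S.inner_atomLp_of_disjoint_of_le μ hμ ρ ρ' y y' hk h
  · exact inner_eq_zero_symm.1 (S.inner_atomLp_of_disjoint_of_le μ hμ ρ' ρ y' y hk h.symm)

end Atoms

/-! ### Totality of the atoms in `L²` -/

section Totality

variable {G : Type*} [AddCommGroup G] [TopologicalSpace G] [IsTopologicalAddGroup G]
  {p : ℕ} (S : ZeroDimGroup G p)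

theorem finite_quotient_chain (k n : ℤ) :
    Finite (S.chain n ⧸ (S.chain k).addSubgroupOf (S.chain n)) := by
  refine Nat.finite_of_card_ne_zero ?_
  change (S.chain k).relIndex (S.chain n) ≠ 0
  rcases le_total n k with h | h
  · have := S.relIndex_chain_add n (k - n).toNat
    rw [show n + ((k - n).toNat : ℤ) = k by omega] at this
    rw [this]
    exact pow_ne_zero _ S.prime.ne_zero
  · rw [AddSubgroup.relIndex_eq_one.2 (S.chain_anti h)]
    exact one_ne_zero

/-- `G` is the union of countably many `G_n`, each with finite image modulo `G_k`. This makes `G`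
second countable, so that the balls generate the Borel sets. -/
theorem countable_quotient_chain (k : ℤ) : Countable (G ⧸ S.chain k) := by
  have := S.finite_quotient_chain k
  have hf : Function.Surjective fun z : (Σ n : ℤ, S.chain n ⧸ (S.chain k).addSubgroupOf (S.chain n)) =>
      ((z.2.out : G) : G ⧸ S.chain k) := by
    intro q
    obtain ⟨x, rfl⟩ := QuotientAddGroup.mk_surjective q
    obtain ⟨n, hn⟩ := S.exists_mem_chain x
    refine ⟨⟨n, ((⟨x, hn⟩ : S.chain n) : S.chain n ⧸ _)⟩, ?_⟩
    dsimp only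
    rw [QuotientAddGroup.eq]
    have h := QuotientAddGroup.eq.1 (QuotientAddGroup.out_eq'
      ((⟨x, hn⟩ : S.chain n) : S.chain n ⧸ (S.chain k).addSubgroupOf (S.chain n)))
    simpa [AddSubgroup.mem_addSubgroupOf] using h
  exact hf.countable

theorem countable_range_ball : {s | ∃ y k, s = S.ball y k}.Countable := by
  have := S.countable_quotient_chain
  refine (Set.countable_range fun z : (Σ k : ℤ, G ⧸ S.chain k) => S.ball z.2.out z.1).mono ?_
  rintro _ ⟨y, k, rfl⟩
  refine ⟨⟨k, (y : G ⧸ S.chain k)⟩, ?_⟩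
  have h : y ∈ S.ball ((y : G ⧸ S.chain k).out) k := by
    have := QuotientAddGroup.eq.1 (QuotientAddGroup.out_eq' (y : G ⧸ S.chain k))
    simpa [ball, sub_eq_neg_add] using this
  have h' : (y : G ⧸ S.chain k).out ∈ S.ball y k := by
    have := neg_mem (show _ ∈ S.chain k from h)
    simpa [ball] using this
  exact (S.ball_subset_ball le_rfl (S.mem_ball_self _ _) h').antisymm
    (S.ball_subset_ball le_rfl (S.mem_ball_self _ _) h)

theorem isTopologicalBasis_ball :
    TopologicalSpace.IsTopologicalBasis {s | ∃ y k, s = S.ball y k} := by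
  refine TopologicalSpace.isTopologicalBasis_of_isOpen_of_nhds ?_ ?_
  · rintro _ ⟨y, k, rfl⟩
    exact S.isOpen_ball y k
  · intro y U hy hU
    have hU' : (fun x => y + x) ⁻¹' U ∈ 𝓝 (0 : G) :=
      (continuous_const.add continuous_id).continuousAt.preimage_mem_nhds
        (by simpa using hU.mem_nhds hy)
    obtain ⟨k, hk⟩ := S.exists_chain_subset _ hU'
    refine ⟨_, ⟨y, k, rfl⟩, S.mem_ball_self y k, fun x hx => ?_⟩
    simpa using hk hx

theorem isPiSystem_ball : IsPiSystem {s | ∃ y k, s = S.ball y k} := by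
  rintro _ ⟨y, k, rfl⟩ _ ⟨y', k', rfl⟩ ⟨x, hx, hx'⟩
  rcases le_total k' k with h | h
  · exact ⟨y, k, Set.inter_eq_left.2 (S.ball_subset_ball h hx hx')⟩
  · exact ⟨y', k', Set.inter_eq_right.2 (S.ball_subset_ball h hx' hx)⟩

variable [MeasurableSpace G] [BorelSpace G]

theorem generateFrom_ball (S : ZeroDimGroup G p) (mG : MeasurableSpace G) [BorelSpace G] :
    mG = MeasurableSpace.generateFrom {s | ∃ y k, s = S.ball y k} := by
  have : SecondCountableTopology G :=
    S.isTopologicalBasis_ball.secondCountableTopology S.countable_range_ball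
  rw [BorelSpace.measurable_eq (α := G)]
  exact S.isTopologicalBasis_ball.borel_eq_generateFrom

/-- A π-λ argument inside each ball `G_n`, where `f` is integrable; countably many of these balls
cover `G`. -/
theorem ae_eq_zero_of_setIntegral_ball {μ : Measure G} {f : G → ℂ}
    (hf : ∀ y k, IntegrableOn f (S.ball y k) μ) (h0 : ∀ y k, ∫ x in S.ball y k, f x ∂μ = 0) :
    f =ᵐ[μ] 0 := by
  have key : ∀ (n : ℤ) (A : Set G), MeasurableSet A →
      ∫ x in A, f x ∂(μ.restrict (S.ball 0 n)) = 0 := by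
    intro n A hA
    have hint : Integrable f (μ.restrict (S.ball 0 n)) := hf 0 n
    induction A, hA using MeasurableSpace.induction_on_inter (S.generateFrom_ball _)
      S.isPiSystem_ball with
    | empty => simp
    | basic A hA =>
      obtain ⟨y, k, rfl⟩ := hA
      rw [Measure.restrict_restrict (S.measurableSet_ball y k)]
      by_cases hne : (S.ball y k ∩ S.ball 0 n).Nonempty
      · obtain ⟨y', k', h⟩ := S.isPiSystem_ball _ ⟨y, k, rfl⟩ _ ⟨0, n, rfl⟩ hne
        rw [h]
        exact h0 y' k'
      · simp [Set.not_nonempty_iff_eq_empty.1 hne]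
    | compl A hA ih =>
      have := integral_add_compl hA hint
      rw [ih, zero_add, h0] at this
      exact this
    | iUnion A hd hA ih =>
      rw [integral_iUnion hA hd hint.integrableOn]
      simp [ih]
  have hae : ∀ n : ℤ, f =ᵐ[μ.restrict (S.ball 0 n)] 0 := fun n =>
    Integrable.ae_eq_zero_of_forall_setIntegral_eq_zero (hf 0 n) fun A hA _ => key n A hA
  have hU : (⋃ n : ℤ, S.ball 0 n) = Set.univ := by
    refine Set.eq_univ_of_forall fun x => ?_
    obtain ⟨n, hn⟩ := S.exists_mem_chain x
    exact Set.mem_iUnion.2 ⟨n, by simpa [ball] using hn⟩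
  have := (ae_restrict_iUnion_iff (μ := μ) (fun n : ℤ => S.ball 0 n) (fun x => f x = 0)).2 hae
  rwa [hU, Measure.restrict_univ] at this

variable (μ : Measure G) [μ.IsAddHaarMeasure] (hμ : μ (S.chain 0 : Set G) = 1)

theorem eq_zero_of_inner_atomLp_one (f : Lp ℂ 2 μ)
    (h : ∀ k y, inner ℂ (S.atomLp μ hμ 1 k y) f = 0) : f = 0 := by
  have hind : ∀ y k, (fun x => conj (S.atom 1 k y x) * f x) = (S.ball y k).indicator f := by
    intro y k
    funext x
    rw [S.atom_eq_indicator]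
    by_cases hx : x ∈ S.ball y k <;> simp [hx, charVal_one]
  refine (Lp.eq_zero_iff_ae_eq_zero).2 (S.ae_eq_zero_of_setIntegral_ball (fun y k => ?_) fun y k => ?_)
  · have := S.integrable_atom_mul μ hμ 1 k y f
    rwa [hind, integrable_indicator_iff (S.measurableSet_ball y k)] at this
  · have := h k y
    rwa [S.inner_atomLp, hind, integral_indicator (S.measurableSet_ball y k)] at this

variable [MeasurableSpace (CharGroup G)] [BorelSpace (CharGroup G)]
  (ν : Measure (CharGroup G)) [ν.IsHaarMeasure]

/-- Both sides are the integral of `(χ, x - y)` over the annulus, computed from its partition into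
cosets and as a difference of two annihilators. -/
theorem sum_atom_eq (hν : ν (S.ann 0) = 1) {Λ : Type*} (ρ : Λ → CharGroup G) (k : Λ → ℤ) (F : Finset Λ) (n : ℤ)
    (hd : (F : Set Λ).Pairwise fun i j => Disjoint (S.annCoset (ρ i) (k i)) (S.annCoset (ρ j) (k j)))
    (hU : ⋃ l ∈ F, S.annCoset (ρ l) (k l) = S.ann (n + 1) \ S.ann n) (y x : G) :
    ∑ l ∈ F, (p : ℂ) ^ k l * S.atom (ρ l) (k l) y x =
      (p : ℂ) ^ (n + 1) * S.atom 1 (n + 1) y x - (p : ℂ) ^ n * S.atom 1 n y x := by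
  have h1 : ∀ k, S.annCoset 1 k = S.ann k := fun k => by simp [annCoset]
  simp only [atom]
  simp only [← S.setIntegral_annCoset_charVal ν hν]
  rw [← integral_biUnion_finset _ (fun l _ => S.measurableSet_annCoset _ _) hd
    (fun l _ => S.integrableOn_charVal ν hν _ _ _), hU, h1, h1,
    setIntegral_sdiff (S.measurableSet_ann n) ?_ (S.ann_mono (by omega))]
  have := S.integrableOn_charVal ν hν 1 (n + 1) (x - y)
  rwa [h1] at this

/-- The atoms attached to a partition of all annuli `Gₙ₊₁^⊥ \ Gₙ^⊥` are total in `L²`. -/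
theorem eq_zero_of_inner_atomLp (hν : ν (S.ann 0) = 1) {Λ : Type*} (ρ : Λ → CharGroup G) (k : Λ → ℤ) (F : ℤ → Finset Λ)
    (hd : Pairwise fun i j => Disjoint (S.annCoset (ρ i) (k i)) (S.annCoset (ρ j) (k j)))
    (hU : ∀ n, ⋃ l ∈ F n, S.annCoset (ρ l) (k l) = S.ann (n + 1) \ S.ann n) (f : Lp ℂ 2 μ)
    (h : ∀ l y, inner ℂ (S.atomLp μ hμ (ρ l) (k l) y) f = 0) : f = 0 := by
  have hp : (1 : ℝ) < p := by exact_mod_cast S.prime.one_lt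
  have hp0 : (p : ℂ) ≠ 0 := by exact_mod_cast S.prime.ne_zero
  refine S.eq_zero_of_inner_atomLp_one μ hμ f fun n y => ?_
  have step : ∀ n, (p : ℂ) ^ (n + 1) * inner ℂ (S.atomLp μ hμ 1 (n + 1) y) f =
      (p : ℂ) ^ n * inner ℂ (S.atomLp μ hμ 1 n y) f := by
    intro n
    have hx : ∀ x, ∑ l ∈ F n, (p : ℂ) ^ k l * (conj (S.atom (ρ l) (k l) y x) * f x) =
        (p : ℂ) ^ (n + 1) * (conj (S.atom 1 (n + 1) y x) * f x) -
          (p : ℂ) ^ n * (conj (S.atom 1 n y x) * f x) := by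
      intro x
      have := congrArg (fun z => conj z * f x)
        (S.sum_atom_eq ν hν ρ k (F n) n (fun i _ j _ hij => hd hij) (hU n) y x)
      simp only [map_sum, map_mul, map_sub, map_zpow₀, Complex.conj_natCast, Finset.sum_mul,
        sub_mul, mul_assoc] at this
      exact this
    have hsum := congrArg (fun u : G → ℂ => ∫ x, u x ∂μ) (funext hx)
    rw [integral_finsetSum _ (fun l _ => (S.integrable_atom_mul μ hμ _ _ _ f).const_mul _),
      integral_sub ((S.integrable_atom_mul μ hμ _ _ _ f).const_mul _)
        ((S.integrable_atom_mul μ hμ _ _ _ f).const_mul _)] at hsum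
    simp only [integral_const_mul, ← S.inner_atomLp μ hμ, h, mul_zero, Finset.sum_const_zero]
      at hsum
    exact (sub_eq_zero.1 hsum.symm)
  have hconst : ∀ i : ℕ, (p : ℂ) ^ (n - i) * inner ℂ (S.atomLp μ hμ 1 (n - i) y) f =
      (p : ℂ) ^ n * inner ℂ (S.atomLp μ hμ 1 n y) f := by
    intro i
    induction i with
    | zero => simp
    | succ i ih =>
      rw [← ih, ← step, show n - ((i + 1 : ℕ) : ℤ) + 1 = n - i by push_cast; ring]
  set c := (p : ℂ) ^ n * inner ℂ (S.atomLp μ hμ 1 n y) f with hc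
  -- Cauchy–Schwarz at level `n - i`: the weight squared is `p^{2(n-i)}` and the ball has measure
  -- `p^{-(n-i)}`, which leaves `p^{n-i}`.
  have hbound : ∀ i : ℕ, ‖c‖ ^ 2 ≤ ((p : ℝ) ^ n * ‖f‖ ^ 2) * ((p : ℝ)⁻¹) ^ i := by
    intro i
    rw [← hconst i, norm_mul, mul_pow]
    have h1 := norm_inner_le_norm (𝕜 := ℂ) (S.atomLp μ hμ 1 (n - i) y) f
    have h2 : ‖inner ℂ (S.atomLp μ hμ 1 (n - i) y) f‖ ^ 2 ≤ (p : ℝ) ^ (-(n - i)) * ‖f‖ ^ 2 := by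
      rw [← S.norm_sq_atomLp μ hμ 1 (n - i) y, ← mul_pow]
      exact pow_le_pow_left₀ (norm_nonneg _) h1 2
    refine (mul_le_mul_of_nonneg_left h2 (sq_nonneg _)).trans (le_of_eq ?_)
    have hp0' : (p : ℝ) ≠ 0 := by positivity
    rw [norm_zpow, Complex.norm_natCast, zpow_neg, zpow_sub₀ hp0', zpow_natCast, inv_pow]
    field_simp
  have hlim : Tendsto (fun i : ℕ => ((p : ℝ) ^ n * ‖f‖ ^ 2) * ((p : ℝ)⁻¹) ^ i) atTop (𝓝 0) := by
    simpa using (tendsto_pow_atTop_nhds_zero_of_lt_one (by positivity)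
      (inv_lt_one_of_one_lt₀ hp)).const_mul ((p : ℝ) ^ n * ‖f‖ ^ 2)
  have hc0 : c = 0 := by
    have := ge_of_tendsto' hlim hbound
    have h2 : ‖c‖ = 0 := by nlinarith [norm_nonneg c, sq_nonneg ‖c‖]
    exact norm_eq_zero.1 h2
  exact (mul_eq_zero.1 (hc ▸ hc0)).resolve_left (zpow_ne_zero _ hp0)

end Totality

/-! ### `H₀` as a set of representatives of `G/G₀` -/

section Translations

variable {G : Type*} [AddCommGroup G] [TopologicalSpace G] {p : ℕ} (S : ZeroDimGroup G p)

theorem Icc_neg_succ (s : ℕ) : Finset.Icc (-((s + 1 : ℕ) : ℤ)) (-1) =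
    insert (-((s + 1 : ℕ) : ℤ)) (Finset.Icc (-(s : ℤ)) (-1)) := by
  ext k
  simp only [Finset.mem_Icc, Finset.mem_insert]
  omega

theorem neg_succ_notMem_Icc (s : ℕ) :
    -((s + 1 : ℕ) : ℤ) ∉ Finset.Icc (-(s : ℤ)) (-1) := by
  simp

theorem exists_digits_sub_mem (s : ℕ) (x : G) (hx : x ∈ S.chain (-(s : ℤ))) :
    ∃ a : ℤ → Fin p, x - ∑ k ∈ Finset.Icc (-(s : ℤ)) (-1), (a k : ℕ) • S.g k ∈ S.chain 0 := by
  induction s generalizing x with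
  | zero => exact ⟨fun _ => ⟨0, S.prime.pos⟩, by simpa using hx⟩
  | succ s ih =>
    obtain ⟨d, hd, hxd⟩ := S.exists_digit _ x hx
    obtain ⟨a, ha⟩ := ih _ (by convert hxd using 2; push_cast; ring)
    refine ⟨Function.update a (-((s + 1 : ℕ) : ℤ)) ⟨d, hd⟩, ?_⟩
    have hsum : ∑ k ∈ Finset.Icc (-(s : ℤ)) (-1),
        (Function.update a (-((s + 1 : ℕ) : ℤ)) ⟨d, hd⟩ k : ℕ) • S.g k =
        ∑ k ∈ Finset.Icc (-(s : ℤ)) (-1), (a k : ℕ) • S.g k := by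
      refine Finset.sum_congr rfl fun k hk => ?_
      have hne : k ≠ -((s + 1 : ℕ) : ℤ) := fun h => neg_succ_notMem_Icc s (h ▸ hk)
      rw [Function.update_of_ne hne]
    rw [Icc_neg_succ, Finset.sum_insert (neg_succ_notMem_Icc s), Function.update_self, hsum]
    rwa [← sub_sub]

/-- Modulo the next subgroup only the term of lowest index survives, so its coefficient is zero;
remove it and repeat. -/
theorem sum_zsmul_g_eq_zero (s : ℕ) (c : ℤ → ℤ) (hc : ∀ k, |c k| < p)
    (h : ∑ k ∈ Finset.Icc (-(s : ℤ)) (-1), c k • S.g k ∈ S.chain 0) :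
    ∑ k ∈ Finset.Icc (-(s : ℤ)) (-1), c k • S.g k = 0 := by
  induction s with
  | zero => simp
  | succ s ih =>
    rw [Icc_neg_succ, Finset.sum_insert (neg_succ_notMem_Icc s)] at h ⊢
    have hrest : ∑ k ∈ Finset.Icc (-(s : ℤ)) (-1), c k • S.g k ∈ S.chain (-(s : ℤ)) :=
      sum_mem fun k hk => zsmul_mem (S.chain_anti (Finset.mem_Icc.1 hk).1 (S.g_mem k)) _
    have hc0 : c (-((s + 1 : ℕ) : ℤ)) = 0 := by
      refine S.eq_zero_of_zsmul_g_mem (-((s + 1 : ℕ) : ℤ)) _ (hc _) ?_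
      rw [show -((s + 1 : ℕ) : ℤ) + 1 = -(s : ℤ) by push_cast; ring]
      have := sub_mem (S.chain_anti (show -(s : ℤ) ≤ 0 by omega) h) hrest
      rwa [add_sub_cancel_right] at this
    rw [hc0, zero_zsmul, zero_add] at h ⊢
    exact ih h

theorem exists_mem_H₀ (x : G) : ∃ h : S.H₀, x - h ∈ S.chain 0 := by
  obtain ⟨n, hn⟩ := S.exists_mem_chain x
  obtain ⟨a, ha⟩ := S.exists_digits_sub_mem (-n).toNat x (S.chain_anti (by omega) hn)
  exact ⟨⟨_, _, a, rfl⟩, ha⟩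

theorem H₀_injective {h h' : G} (hh : h ∈ S.H₀) (hh' : h' ∈ S.H₀) (hs : h - h' ∈ S.chain 0) :
    h = h' := by
  obtain ⟨s, a, rfl⟩ := hh
  obtain ⟨s', a', rfl⟩ := hh'
  -- Pads both expansions with zeros to a common length, with integer coefficients so that they can
  -- be subtracted.
  have ext0 : ∀ (s N : ℕ) (a : ℤ → Fin p), s ≤ N →
      ∑ k ∈ Finset.Icc (-(s : ℤ)) (-1), (a k : ℕ) • S.g k =
        ∑ k ∈ Finset.Icc (-(N : ℤ)) (-1), (if -(s : ℤ) ≤ k then ((a k : ℕ) : ℤ) else 0) • S.g k := by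
    intro s N a hsN
    rw [← Finset.sum_subset (Finset.Icc_subset_Icc_left (show -(N : ℤ) ≤ -(s : ℤ) by omega))]
    · refine Finset.sum_congr rfl fun k hk => ?_
      rw [if_pos (Finset.mem_Icc.1 hk).1, natCast_zsmul]
    · intro k hk hk'
      rw [if_neg, zero_zsmul]
      intro h
      exact hk' (Finset.mem_Icc.2 ⟨h, (Finset.mem_Icc.1 hk).2⟩)
  have hle := le_max_left s s'
  have hle' := le_max_right s s'
  rw [ext0 s _ a hle, ext0 s' _ a' hle', ← Finset.sum_sub_distrib] at hs
  rw [ext0 s _ a hle, ext0 s' _ a' hle', ← sub_eq_zero, ← Finset.sum_sub_distrib]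
  simp only [← sub_smul] at hs ⊢
  refine S.sum_zsmul_g_eq_zero _ _ (fun k => ?_) hs
  have h1 := (a k).2
  have h2 := (a' k).2
  rw [abs_lt]
  split_ifs <;> omega

/-- The map `h ↦ h - z` is a bijection onto `G_{-s}/G₀`, because `H₀` meets every coset of `G₀`
exactly once. -/
theorem card_H₀_inter_coset (s : ℕ) (z : G) :
    Nat.card {h : S.H₀ // (h : G) - z ∈ S.chain (-(s : ℤ))} = p ^ s := by
  have hidx := S.relIndex_chain_add (-(s : ℤ)) s
  rw [neg_add_cancel] at hidx
  rw [← hidx]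
  refine Nat.card_eq_of_bijective
    (fun h => ((⟨_, h.2⟩ : S.chain (-(s : ℤ))) :
      S.chain (-(s : ℤ)) ⧸ (S.chain 0).addSubgroupOf (S.chain (-(s : ℤ))))) ⟨?_, ?_⟩
  · rintro ⟨h, hh⟩ ⟨h', hh'⟩ heq
    have := QuotientAddGroup.eq.1 heq
    rw [AddSubgroup.mem_addSubgroupOf] at this
    refine Subtype.ext (Subtype.ext (S.H₀_injective h'.2 h.2 ?_).symm)
    convert this using 1
    simp only [AddSubgroup.coe_add, AddSubgroup.coe_neg]
    abel
  · intro c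
    obtain ⟨⟨d, hd⟩, rfl⟩ := QuotientAddGroup.mk_surjective c
    obtain ⟨h, hh⟩ := S.exists_mem_H₀ (z + d)
    refine ⟨⟨h, ?_⟩, ?_⟩
    · have := sub_mem hd (S.chain_anti (show -(s : ℤ) ≤ 0 by omega) hh)
      convert this using 1
      abel
    · refine QuotientAddGroup.eq.2 ?_
      rw [AddSubgroup.mem_addSubgroupOf]
      convert hh using 1
      simp only [AddSubgroup.coe_add, AddSubgroup.coe_neg]
      abel

end Translations

/-! ### Wavelets as rescaled atoms, and the orthonormal system behind them -/

section Wavelets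

variable {G : Type*} [AddCommGroup G] [TopologicalSpace G] [IsTopologicalAddGroup G]
  {p : ℕ} (S : ZeroDimGroup G p)

theorem card_H₀_fiber (s : ℕ) (n : ℤ) (c : G ⧸ S.chain (-(s : ℤ) + n)) :
    Nat.card {h : S.H₀ // ((S.dilPow (-n) h : G) : G ⧸ S.chain (-(s : ℤ) + n)) = c} = p ^ s := by
  obtain ⟨y, rfl⟩ := QuotientAddGroup.mk_surjective c
  rw [← S.card_H₀_inter_coset s (S.dilPow n y)]
  refine Nat.card_congr (Equiv.subtypeEquivRight fun h => ?_)
  rw [eq_comm, QuotientAddGroup.eq, ← S.dilPow_mem_iff, map_add, map_neg, S.dilPow_dilPow_neg,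
    neg_add_eq_sub]

theorem atom_dilPow_sub (ρ : CharGroup G) (k n : ℤ) (h x : G) :
    S.atom ρ k 0 (S.dilPow n x - h) = S.atom (S.charDil n ρ) (k + n) (S.dilPow (-n) h) x := by
  have hx : S.dilPow n x - h = S.dilPow n (x - S.dilPow (-n) h) := by
    rw [map_sub, S.dilPow_dilPow_neg]
  rw [hx, atom, atom, sub_zero]
  by_cases hm : x - S.dilPow (-n) h ∈ S.chain (k + n)
  · rw [Set.indicator_of_mem (show _ ∈ S.chain k from (S.dilPow_mem_iff _ _ _).2 hm),
      Set.indicator_of_mem hm, charVal_charDil]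
  · rw [Set.indicator_of_notMem (show _ ∉ S.chain k from fun h => hm ((S.dilPow_mem_iff _ _ _).1 h)),
      Set.indicator_of_notMem hm]

variable [MeasurableSpace G] [BorelSpace G] [MeasurableSpace (CharGroup G)]
  [BorelSpace (CharGroup G)]

theorem wavelet_eq_atom (μ : Measure G) (ν : Measure (CharGroup G)) [ν.IsHaarMeasure]
    (hν : ν (S.ann 0) = 1) (φ : G → ℂ) (m : CharGroup G → ℂ) (ρ : CharGroup G) (k : ℤ)
    (hm : ∀ χ, fourierTr μ φ (S.charDil (-1) χ) * m χ = (S.annCoset ρ k).indicator 1 χ) (x : G) :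
    S.wavelet μ ν φ m x = (p : ℂ) ^ k * S.atom ρ k 0 x := by
  rw [wavelet, invFourierTr, atom, sub_zero, ← S.setIntegral_annCoset_charVal ν hν,
    ← integral_indicator (S.measurableSet_annCoset ρ k)]
  congr 1
  funext χ
  rw [hm]
  by_cases hχ : χ ∈ S.annCoset ρ k <;> simp [hχ]

variable (μ : Measure G) [μ.IsAddHaarMeasure] (hμ : μ (S.chain 0 : Set G) = 1)

/-- The orthonormal system of normalized atoms attached to a family of cosets of annihilators. -/
noncomputable def atomSystem {Λ : Type*} (ρ : Λ → CharGroup G) (k : Λ → ℤ)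
    (i : Σ l : Λ, G ⧸ S.chain (k l)) : Lp ℂ 2 μ :=
  ((Real.sqrt ((p : ℝ) ^ k i.1) : ℝ) : ℂ) • S.atomLp μ hμ (ρ i.1) (k i.1) i.2.out

/-- Frees the computation from the chosen centre `out`: any `y` in the ball gives the same modulus.
-/
theorem norm_sq_inner_atomSystem {Λ : Type*} (ρ : Λ → CharGroup G) (k : Λ → ℤ)
    (l : Λ) (y : G) (f : Lp ℂ 2 μ) :
    ‖inner ℂ (S.atomSystem μ hμ ρ k ⟨l, y⟩) f‖ ^ 2 =
      (p : ℝ) ^ k l * ‖inner ℂ (S.atomLp μ hμ (ρ l) (k l) y) f‖ ^ 2 := by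
  have h : y - (y : G ⧸ S.chain (k l)).out ∈ S.chain (k l) := by
    have := QuotientAddGroup.eq.1 (QuotientAddGroup.out_eq' (y : G ⧸ S.chain (k l)))
    rwa [neg_add_eq_sub] at this
  rw [atomSystem, inner_smul_left, norm_mul, mul_pow, RCLike.norm_conj,
    S.norm_inner_atomLp_eq μ hμ _ _ h, Complex.norm_real, Real.norm_eq_abs, sq_abs,
    Real.sq_sqrt (by positivity)]

theorem orthonormal_atomSystem {Λ : Type*} (ρ : Λ → CharGroup G) (k : Λ → ℤ)
    (hd : Pairwise fun i j => Disjoint (S.annCoset (ρ i) (k i)) (S.annCoset (ρ j) (k j))) :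
    Orthonormal ℂ (S.atomSystem μ hμ ρ k) := by
  have hp : (p : ℝ) ≠ 0 := by exact_mod_cast S.prime.ne_zero
  refine ⟨fun i => ?_, ?_⟩
  · have : ‖S.atomSystem μ hμ ρ k i‖ ^ 2 = 1 := by
      rw [atomSystem, norm_smul, mul_pow, S.norm_sq_atomLp, Complex.norm_real, Real.norm_eq_abs,
        sq_abs, Real.sq_sqrt (by positivity), ← zpow_add₀ hp, add_neg_cancel, zpow_zero]
    exact (pow_eq_one_iff_of_nonneg (norm_nonneg _) two_ne_zero).1 this
  · rintro ⟨l, c⟩ ⟨l', c'⟩ hne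
    simp only [atomSystem]
    rw [inner_smul_left, inner_smul_right]
    suffices h : inner ℂ (S.atomLp μ hμ (ρ l) (k l) c.out)
        (S.atomLp μ hμ (ρ l') (k l') c'.out) = 0 by rw [h, mul_zero, mul_zero]
    by_cases hl : l = l'
    · subst hl
      refine S.inner_atomLp_of_disjoint_ball μ hμ _ _ (Set.disjoint_left.2 fun x hx hx' => hne ?_)
      congr 1
      rw [← QuotientAddGroup.out_eq' c, ← QuotientAddGroup.out_eq' c', QuotientAddGroup.eq]
      have := sub_mem (show _ ∈ S.chain (k l) from hx) (show _ ∈ S.chain (k l) from hx')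
      rw [sub_sub_sub_cancel_left] at this
      rwa [neg_add_eq_sub]
    · exact S.inner_atomLp_of_disjoint μ hμ _ _ _ _ (hd hl)

end Wavelets

/-! ### Dilates of the cosets partition all annuli -/

section Partition

variable {G : Type*} [AddCommGroup G] [TopologicalSpace G] [IsTopologicalAddGroup G]
  {p : ℕ} (S : ZeroDimGroup G p)

theorem eq_of_mem_annulus {χ : CharGroup G} {d d' : ℤ} (h : χ ∈ S.ann (d + 1) \ S.ann d)
    (h' : χ ∈ S.ann (d' + 1) \ S.ann d') : d = d' := by
  rcases lt_trichotomy d d' with hlt | rfl | hlt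
  · exact absurd (S.ann_mono (by omega) h.1) h'.2
  · rfl
  · exact absurd (S.ann_mono (by omega) h'.1) h.2

variable {J : Type*} (E : J → Set (CharGroup G)) (t : J → ℤ) (M : ℤ)

theorem charDil_image_image (k l : ℤ) (D : Set (CharGroup G)) :
    S.charDil k '' (S.charDil l '' D) = S.charDil (k + l) '' D := by
  rw [Set.image_image]
  simp only [S.charDil_charDil]

/-- If dilates of the sets `Eⱼ` partition one annulus, then all their dilates are disjoint. -/
theorem pairwise_disjoint_dilates
    (htd : Pairwise fun i j => Disjoint (S.charDil (t i) '' E i) (S.charDil (t j) '' E j))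
    (ht : ⋃ j, S.charDil (t j) '' E j = S.ann (M + 1) \ S.ann M) :
    Pairwise fun i j : J × ℤ => Disjoint (S.charDil i.2 '' E i.1) (S.charDil j.2 '' E j.1) := by
  rintro ⟨j, n⟩ ⟨j', n'⟩ hne
  refine Set.disjoint_left.2 fun χ hχ hχ' => hne ?_
  have hmem : ∀ (j : J) (n : ℤ), χ ∈ S.charDil n '' E j →
      S.charDil (t j - n) χ ∈ S.charDil (t j) '' E j := by
    rintro j n ⟨η, hη, rfl⟩
    exact ⟨η, hη, by rw [S.charDil_charDil, sub_add_cancel]⟩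
  -- The annulus containing `χ` determines `t j - n`, so two dilates containing `χ` are carried into
  -- the partitioned annulus by the same power of `𝒜`.
  have hann : ∀ (j : J) (n : ℤ), χ ∈ S.charDil n '' E j →
      χ ∈ S.ann (M - (t j - n) + 1) \ S.ann (M - (t j - n)) := by
    intro j n h
    have h1 : S.charDil (t j - n) χ ∈ S.ann (M + 1) \ S.ann M :=
      ht ▸ Set.mem_iUnion.2 ⟨j, hmem j n h⟩
    rw [Set.mem_sdiff, S.charDil_mem_ann, S.charDil_mem_ann] at h1
    rwa [sub_add_eq_add_sub]
  have hd : t j - n = t j' - n' := by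
    have := S.eq_of_mem_annulus (hann j n hχ) (hann j' n' hχ')
    omega
  have hj : j = j' := by
    by_contra hj
    refine Set.disjoint_left.1 (htd hj) (hmem j n hχ) ?_
    rw [hd]
    exact hmem j' n' hχ'
  subst hj
  rw [show n = n' by omega]

/-- The power `n - M` carries the given annulus to the one at level `n`, hence the exponents `n - M
+ t j`. -/
theorem biUnion_dilates [Fintype J] [DecidableEq J]
    (ht : ⋃ j, S.charDil (t j) '' E j = S.ann (M + 1) \ S.ann M) (n : ℤ) :
    ⋃ l ∈ Finset.univ.image fun j => (j, n - M + t j), S.charDil l.2 '' E l.1 =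
      S.ann (n + 1) \ S.ann n := by
  have := S.image_charDil_annulus (n - M) M
  rw [← ht, Set.image_iUnion, show M + (n - M) = n by ring] at this
  rw [← this, Finset.set_biUnion_finset_image]
  simp [S.charDil_image_image]

end Partition

end ZeroDimGroup

/-! ### The main theorem -/

theorem theorem3p1 {G : Type*} [AddCommGroup G] [TopologicalSpace G] [IsTopologicalAddGroup G]
    [LocallyCompactSpace G] [MeasurableSpace G] [BorelSpace G]
    [MeasurableSpace (CharGroup G)] [BorelSpace (CharGroup G)]
    {p : ℕ} (S : ZeroDimGroup G p)
    (μ : Measure G) [μ.IsAddHaarMeasure] (hμ : μ (S.chain 0 : Set G) = 1)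
    (ν : Measure (CharGroup G)) [ν.IsHaarMeasure] (hν : ν (S.ann 0) = 1)
    (M N : ℕ) (φ : G → ℂ) (hφ : S.IsStep M N φ)
    (m₀ : CharGroup G → ℂ) (hφm₀ : S.IsRefinable ν φ m₀)
    (q : ℕ) (m : Fin q → CharGroup G → ℂ)
    (s : Fin q → ℕ) (α : Fin q → ℤ → Fin p)
    (hm : ∀ j χ, fourierTr μ φ (S.charDil (-1) χ) * m j χ =
      (S.coset (s j) M (α j)).indicator 1 χ)
    (hE : Pairwise fun i j => Disjoint (S.coset (s i) M (α i)) (S.coset (s j) M (α j)))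
    (hEt : ∀ t : ℤ, Pairwise fun i j =>
      Disjoint (S.charDil t '' S.coset (s i) M (α i)) (S.charDil t '' S.coset (s j) M (α j)))
    (t : Fin q → ℕ)
    (htd : Pairwise fun i j => Disjoint (S.charDil (t i) '' S.coset (s i) M (α i))
      (S.charDil (t j) '' S.coset (s j) M (α j)))
    (ht : ⋃ j, S.charDil (t j) '' S.coset (s j) M (α j) = S.ann (M + 1) \ S.ann M) :
    ∃ hψ : ∀ i : Fin q × ℤ × S.H₀,
        MemLp (S.affine (S.wavelet μ ν φ (m i.1)) i.2.1 (i.2.2 : G)) 2 μ,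
      IsParsevalFrame (fun i => (hψ i).toLp) := by
  have hp : (0 : ℝ) < p := by exact_mod_cast S.prime.pos
  let R : Fin q → CharGroup G := fun j =>
    ∏ k ∈ Finset.Icc (-(s j : ℤ)) (M : ℤ), S.r k ^ (α j k : ℕ)
  have hcos : ∀ j, S.coset (s j) M (α j) = S.annCoset (R j) (-(s j : ℤ)) := fun j =>
    S.coset_eq_annCoset _ _ _
  let ρ : Fin q × ℤ → CharGroup G := fun l => S.charDil l.2 (R l.1)
  let k : Fin q × ℤ → ℤ := fun l => -(s l.1 : ℤ) + l.2
  have himg : ∀ l : Fin q × ℤ,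
      S.charDil l.2 '' S.coset (s l.1) M (α l.1) = S.annCoset (ρ l) (k l) := fun l => by
    rw [hcos, S.image_annCoset]
  have hd : Pairwise fun i j => Disjoint (S.annCoset (ρ i) (k i)) (S.annCoset (ρ j) (k j)) := by
    have := S.pairwise_disjoint_dilates (fun j => S.coset (s j) M (α j)) (fun j => (t j : ℤ)) M
      htd ht
    simpa only [himg] using this
  have hU : ∀ n, ⋃ l ∈ Finset.univ.image fun j => (j, n - M + (t j : ℤ)),
      S.annCoset (ρ l) (k l) = S.ann (n + 1) \ S.ann n := by
    intro n
    have := S.biUnion_dilates (fun j => S.coset (s j) M (α j)) (fun j => (t j : ℤ)) M ht n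
    simpa only [himg] using this
  have haff : ∀ i : Fin q × ℤ × S.H₀,
      S.affine (S.wavelet μ ν φ (m i.1)) i.2.1 (i.2.2 : G) =
        ((((p : ℝ) ^ ((i.2.1 : ℝ) / 2) : ℝ) : ℂ) * (p : ℂ) ^ (-(s i.1 : ℤ))) •
          S.atom (ρ (i.1, i.2.1)) (k (i.1, i.2.1)) (S.dilPow (-i.2.1) i.2.2) := by
    rintro ⟨j, n, h⟩
    funext x
    dsimp only [ZeroDimGroup.affine, Pi.smul_apply]
    rw [S.wavelet_eq_atom μ ν hν φ (m j) (R j) (-(s j : ℤ)) (fun χ => by rw [hm, hcos]),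
      S.atom_dilPow_sub, smul_eq_mul, mul_assoc]
  have hψ : ∀ i : Fin q × ℤ × S.H₀,
      MemLp (S.affine (S.wavelet μ ν φ (m i.1)) i.2.1 (i.2.2 : G)) 2 μ := fun i => by
    rw [haff]
    exact (S.memLp_atom μ hμ _ _ _).const_smul _
  refine ⟨hψ, ?_⟩
  have htoLp : ∀ i : Fin q × ℤ × S.H₀, (hψ i).toLp =
      ((((p : ℝ) ^ ((i.2.1 : ℝ) / 2) : ℝ) : ℂ) * (p : ℂ) ^ (-(s i.1 : ℤ))) •
        S.atomLp μ hμ (ρ (i.1, i.2.1)) (k (i.1, i.2.1)) (S.dilPow (-i.2.1) i.2.2) := fun i => by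
    rw [ZeroDimGroup.atomLp, ← MemLp.toLp_const_smul]
    congr 1
    exact haff i
  -- A wavelet is sent to its dilated coset, indexed by `(j, n)`, and to the ball containing `𝒜⁻ⁿh`;
  -- each basis vector is hit `p ^ s j` times.
  refine isParsevalFrame_of_fibers (S.orthonormal_atomSystem μ hμ ρ k hd) ?_
    (fun i : Fin q × ℤ × S.H₀ => ⟨(i.1, i.2.1), ((S.dilPow (-i.2.1) i.2.2 : G) :
      G ⧸ S.chain (k (i.1, i.2.1)))⟩) (fun i => p ^ s i.1.1)
    (fun i => pow_ne_zero _ S.prime.ne_zero) ?_ ?_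
  · intro f hf
    refine S.eq_zero_of_inner_atomLp μ hμ ν hν ρ k _ hd hU f fun l y => ?_
    have := S.norm_sq_inner_atomSystem μ hμ ρ k l y f
    rw [hf, norm_zero, zero_pow two_ne_zero, eq_comm, mul_eq_zero, sq_eq_zero_iff, norm_eq_zero]
      at this
    exact this.resolve_left (zpow_ne_zero _ hp.ne')
  · rintro ⟨⟨j, n⟩, c⟩
    rw [← S.card_H₀_fiber (s j) n c]
    symm
    refine Nat.card_eq_of_bijective (fun h => ⟨(j, n, h.1), by
      refine Sigma.ext rfl (heq_of_eq h.2)⟩) ⟨?_, ?_⟩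
    · intro h h' heq
      simpa [Subtype.ext_iff] using heq
    · rintro ⟨⟨j', n', h⟩, hh⟩
      obtain ⟨h1, h2⟩ := Sigma.mk.inj_iff.1 hh
      obtain ⟨rfl, rfl⟩ := Prod.mk_inj.1 h1
      exact ⟨⟨h, eq_of_heq h2⟩, rfl⟩
  -- Balance of constants: multiplicity `p^s`, dilation `pⁿ` and squared amplitude `p^{-2s}`
  -- multiply to `p^{n-s}`, the squared normalization of the atom.
  · rintro ⟨j, n, h⟩ f
    rw [S.norm_sq_inner_atomSystem, htoLp, inner_smul_left, norm_mul, RCLike.norm_conj, mul_pow,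
      norm_mul, mul_pow, norm_zpow, Complex.norm_natCast, Complex.norm_real, Real.norm_eq_abs,
      sq_abs, ← Real.rpow_natCast ((p : ℝ) ^ ((n : ℝ) / 2)), ← Real.rpow_mul hp.le]
    dsimp only [k]
    rw [show (n : ℝ) / 2 * ((2 : ℕ) : ℝ) = n by push_cast; ring, Real.rpow_intCast,
      zpow_add₀ hp.ne', zpow_neg, zpow_natCast]
    push_cast
    field_simp
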